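/- **Theorem.** Let $M$ be a compact (Hausdorff, boundaryless, smooth) Riemannian manifold, let $X$ be a Lipschitz vector field on $M$, let $p\in M$, and let $\phi_p:\mathbb R\to M$ be the orbit of $p$ under the flow of $X$ (the integral curve of $X$ with $\phi_p(0)=p$). Suppose that $p$ is *quasi-regular*, i.e. $\lim_{T\to\infty}\frac1T\int_0^T f(\phi_p(t))\,dt$ exists for every continuous $f:M\to\mathbb R$. Put $J_T:=\frac1T(\phi_p)_*\widetilde{[0,T]}$ for $T>0$. Then, as $T\to\infty$, $J_T$ converges to a limit $J_p$ in the Banach space $\hat{\mathcal B}{}^1_1(M)$ of differential $1$-chains of order $1$ on $M$, and $J_p$ is closed: $\partial J_p=0$. *Definitions.* A pointed $k$-chain ($k=0,1$) on a complete Riemannian manifold $N$ is a finite formal sum $\sum_i(p_i;\alpha_i)$ with $p_i\in N$ and $\alpha_i\in\Lambda^kT_{p_i}N$ (so $\alpha_i\in\mathbb R$ for $k=0$ and $\alpha_i\in T_{p_i}N$ for $k=1$), with $(p;\alpha)$ linear in $\alpha$. With $\exp$ and parallel transport along geodesics taken for the Levi-Civita connection, and $u,v\in T_pN$, put $$\Delta_u(p;\alpha)=(\exp_pu;\alpha_u)-(p;\alpha),$$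 where $\alpha_u$ is the parallel transport of $\alpha$ along the geodesic $t\mapsto\exp_p(tu)$, $0\le t\le1$, and, for $k=0$, $$\Delta^2_{(u,v)}(p;a)=(\exp_{q}v';a)-(q;a)-(\exp_pv;a)+(p;a),\qquad q=\exp_pu,$$ where $v'$ is the parallel transport of $v$ to $q$ along $t\mapsto\exp_p(tu)$. Give $(p;\alpha)$, $\Delta_u(p;\alpha)$ and $\Delta^2_{(u,v)}(p;a)$ the weights $\|\alpha\|$, $\|u\|\|\alpha\|$ and $\|u\|\|v\||a|$. The $r$-norm of a pointed chain $A$ is the infimum of the total weight over all finite decompositions of $A$ into such elements with at most $r$ differences, and $\hat{\mathcal B}{}_k^r(N)$ is the completion of the pointed $k$-chains for the $r$-norm; only $\hat{\mathcal B}{}^1_1$ and $\hat{\mathcal B}{}^2_0$ are used here. The chain $\widetilde{[0,T]}\in\hat{\mathcal B}{}_1^1(\mathbb R)$ is $\lim_{n\to\infty}\sum_{i=0}^{2^n-1}\big((i+\tfrac12)2^{-n}T;\,2^{-n}T\big)$. The pushforward $F_*$ and the boundary $\partial:\hat{\mathcal B}{}_1^1(M)\to\hat{\mathcal B}{}_0^2(M)$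 are the extensions by continuity of $F_*(p;v)=(F(p);dF_p v)$ and of $\partial(p;v)=\lim_{t\to0}\big[(\exp_p(tv);1/t)-(p;1/t)\big]$, the latter limit being taken in $\hat{\mathcal B}{}_0^2(M)$. -/

import Mathlib

open scoped Manifold ContDiff Topology
open Bundle Filter Set

noncomputable section

namespace DifferentialChain

/-! ### Norms defined by an infimum over decompositions -/

section Decomposition

variable {P : Type*} [AddCommGroup P]

/-- The costs `∑ wᵢ` of all finite decompositions `A = ∑ cᵢ` into elements `cᵢ` of weight `wᵢ`,
where `S c w` says that `w` is an admissible weight of `c`. -/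
def costs (S : P → ℝ → Prop) (A : P) : Set ℝ :=
  {s | ∃ L : List (P × ℝ), (∀ x ∈ L, S x.1 x.2) ∧
    (L.map Prod.fst).sum = A ∧ (L.map Prod.snd).sum = s}

theorem costs_nonneg {S : P → ℝ → Prop} (h0 : ∀ c w, S c w → 0 ≤ w) {A : P} {s : ℝ}
    (hs : s ∈ costs S A) : 0 ≤ s := by
  obtain ⟨L, hL, -, rfl⟩ := hs
  refine List.sum_nonneg ?_
  intro w hw
  obtain ⟨x, hx, rfl⟩ := List.mem_map.1 hw
  exact h0 _ _ (hL x hx)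

theorem costs_bddBelow {S : P → ℝ → Prop} (h0 : ∀ c w, S c w → 0 ≤ w) (A : P) :
    BddBelow (costs S A) :=
  ⟨0, fun _ hs => costs_nonneg h0 hs⟩

theorem costs_add {S : P → ℝ → Prop} {A B : P} {s t : ℝ} (hs : s ∈ costs S A)
    (ht : t ∈ costs S B) : s + t ∈ costs S (A + B) := by
  obtain ⟨L, hL, rfl, rfl⟩ := hs
  obtain ⟨L', hL', rfl, rfl⟩ := ht
  refine ⟨L ++ L', ?_, by simp, by simp⟩
  intro x hx
  rcases List.mem_append.1 hx with h | h
  · exact hL x h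
  · exact hL' x h

theorem costs_smul [Module ℝ P] {S : P → ℝ → Prop} (hS : ∀ (a : ℝ) c w, S c w → S (a • c) (|a| * w))
    (a : ℝ) {A : P} {s : ℝ} (hs : s ∈ costs S A) : |a| * s ∈ costs S (a • A) := by
  obtain ⟨L, hL, rfl, rfl⟩ := hs
  refine ⟨L.map fun x => (a • x.1, |a| * x.2), ?_, ?_, ?_⟩
  · intro x hx
    obtain ⟨y, hy, rfl⟩ := List.mem_map.1 hx
    exact hS a _ _ (hL y hy)
  · rw [List.smul_sum, List.map_map, List.map_map]; rfl
  · rw [List.map_map]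
    exact List.sum_map_mul_left (f := Prod.snd) ..

/-- The seminorm `A ↦ inf {∑ wᵢ : A = ∑ cᵢ}`. -/
def decompositionSeminorm [Module ℝ P] (S : P → ℝ → Prop) (h0 : ∀ c w, S c w → 0 ≤ w)
    (hS : ∀ (a : ℝ) c w, S c w → S (a • c) (|a| * w)) (hne : ∀ A, (costs S A).Nonempty) :
    Seminorm ℝ P :=
  Seminorm.ofSMulLE (fun A => sInf (costs S A))
    (le_antisymm (csInf_le (costs_bddBelow h0 0) ⟨[], by simp, by simp, by simp⟩)
      (le_csInf (hne 0) fun _ hs => costs_nonneg h0 hs))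
    (fun A B => by
      refine le_of_forall_pos_le_add fun ε hε => ?_
      obtain ⟨s, hs, hs'⟩ := Real.lt_sInf_add_pos (hne A) (half_pos hε)
      obtain ⟨t, ht, ht'⟩ := Real.lt_sInf_add_pos (hne B) (half_pos hε)
      have := csInf_le (costs_bddBelow h0 _) (costs_add hs ht)
      linarith)
    (fun a A => by
      rw [Real.norm_eq_abs]
      refine le_of_forall_pos_le_add fun ε hε => ?_
      have hpos : 0 < |a| + 1 := by positivity
      obtain ⟨s, hs, hs'⟩ := Real.lt_sInf_add_pos (hne A) (div_pos hε hpos)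
      have h1 := csInf_le (costs_bddBelow h0 _) (costs_smul hS a hs)
      have h2 : |a| * s ≤ |a| * (sInf (costs S A) + ε / (|a| + 1)) :=
        mul_le_mul_of_nonneg_left hs'.le (abs_nonneg a)
      have h3 : |a| * (ε / (|a| + 1)) ≤ ε := by
        rw [mul_div_assoc', div_le_iff₀ hpos]
        nlinarith [abs_nonneg a]
      linarith)

end Decomposition

/-- Pointed 0-chains on the manifold `M` modelled on `E`: formal sums `∑ (pᵢ; aᵢ)` with
`aᵢ ∈ Λ⁰ T_{pᵢ}M = ℝ`. They carry the 2-norm defined below. -/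
def PointedZeroChain (_E M : Type*) : Type _ := M →₀ ℝ

/-! ### Parallel transport and geodesics -/

section Riemannian

variable {E : Type*} [NormedAddCommGroup E] [NormedSpace ℝ E]
  {M : Type*} [TopologicalSpace M] [ChartedSpace E M] [IsManifold 𝓘(ℝ, E) ∞ M]

/-- Coordinates of the tangent vector `z` in the frame of the chart at `x₀`. -/
def fiberCoord (x₀ : M) (z : TangentBundle 𝓘(ℝ, E) M) : E :=
  (trivializationAt E (TangentSpace 𝓘(ℝ, E)) x₀ z).2

theorem fiberCoord_smul (x₀ : M) (c : ℝ) (z : TangentBundle 𝓘(ℝ, E) M) :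
    fiberCoord x₀ (⟨z.proj, c • z.2⟩ : TangentBundle 𝓘(ℝ, E) M) = c • fiberCoord x₀ z := by
  simp only [fiberCoord, TangentBundle.trivializationAt_apply]
  exact ContinuousLinearMap.map_smul _ _ _

/-- `X` is a Lipschitz vector field: near every point its coordinate expression is Lipschitz. -/
def IsLipschitzVectorField (X : ∀ x : M, TangentSpace 𝓘(ℝ, E) x) : Prop :=
  ∀ x₀ : M, ∃ K, ∃ N ∈ 𝓝 (extChartAt 𝓘(ℝ, E) x₀ x₀),
    LipschitzOnWith K (fun y : E => fiberCoord x₀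
      ⟨(extChartAt 𝓘(ℝ, E) x₀).symm y, X ((extChartAt 𝓘(ℝ, E) x₀).symm y)⟩) N

variable [RiemannianBundle (fun x : M => TangentSpace 𝓘(ℝ, E) x)]

/-- The Riemannian metric in the chart at `x₀`: `g_y(v, w)` at the point with coordinates `y`. -/
def chartMetric (x₀ : M) (y v w : E) : ℝ :=
  inner ℝ
    ((trivializationAt E (TangentSpace 𝓘(ℝ, E)) x₀).symmL ℝ ((extChartAt 𝓘(ℝ, E) x₀).symm y) v)
    ((trivializationAt E (TangentSpace 𝓘(ℝ, E)) x₀).symmL ℝ ((extChartAt 𝓘(ℝ, E) x₀).symm y) w)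

/-- The Christoffel symbol of the first kind of the Levi-Civita connection in the chart at `x₀`,
`⟨Γ_y(u, v), w⟩ = (∂_u g(v, w) + ∂_v g(u, w) - ∂_w g(u, v)) / 2`. -/
def christoffel (x₀ : M) (y u v w : E) : ℝ :=
  (fderiv ℝ (fun z => chartMetric x₀ z v w) y u + fderiv ℝ (fun z => chartMetric x₀ z u w) y v
    - fderiv ℝ (fun z => chartMetric x₀ z u v) y w) / 2

/-- `V`, a curve in the tangent bundle regarded as a vector field along its base curve `γ`, is
parallel on `s` for the Levi-Civita connection: `V' + Γ(γ', V) = 0` in local coordinates. The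
equation is invariant under changes of coordinates, so any chart around `γ t` may be used. -/
def IsParallelOn (V : ℝ → TangentBundle 𝓘(ℝ, E) M) (s : Set ℝ) : Prop :=
  ContinuousOn (fun t => (V t).proj) s ∧
  ∀ t ∈ s, ∃ x₀ : M, (V t).proj ∈ (chartAt E x₀).source ∧ ∃ a b : E,
    HasDerivWithinAt (fun τ => extChartAt 𝓘(ℝ, E) x₀ (V τ).proj) a s t ∧
    HasDerivWithinAt (fun τ => fiberCoord x₀ (V τ)) b s t ∧
    ∀ w : E, chartMetric x₀ (extChartAt 𝓘(ℝ, E) x₀ (V t).proj) b w +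
      christoffel x₀ (extChartAt 𝓘(ℝ, E) x₀ (V t).proj) a (fiberCoord x₀ (V t)) w = 0

/-- `U` is the velocity field of a geodesic on `s`: it is the derivative of its base curve, and
it is parallel. -/
def IsGeodesicOn (U : ℝ → TangentBundle 𝓘(ℝ, E) M) (s : Set ℝ) : Prop :=
  IsParallelOn U s ∧
  ∀ t ∈ s, HasMFDerivWithinAt 𝓘(ℝ, ℝ) 𝓘(ℝ, E) (fun τ => (U τ).proj) s t
    ((1 : ℝ →L[ℝ] ℝ).smulRight (U t).2)

theorem chartMetric_smul_left (x₀ : M) (y : E) (c : ℝ) (v w : E) :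
    chartMetric x₀ y (c • v) w = c * chartMetric x₀ y v w := by
  simp only [chartMetric, map_smul]
  rw [real_inner_smul_left]

theorem chartMetric_smul_right (x₀ : M) (y : E) (c : ℝ) (v w : E) :
    chartMetric x₀ y v (c • w) = c * chartMetric x₀ y v w := by
  simp only [chartMetric, map_smul]
  rw [real_inner_smul_right]

theorem christoffel_smul (x₀ : M) (y : E) (c : ℝ) (u v w : E) :
    christoffel x₀ y u (c • v) w = c * christoffel x₀ y u v w := by
  have h (f : E → ℝ) (x : E) : fderiv ℝ (fun z => c * f z) x = c • fderiv ℝ f x :=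
    congrFun (fderiv_const_smul_field (f := f) c) x
  simp only [christoffel, chartMetric_smul_left, chartMetric_smul_right, h, map_smul,
    smul_apply, smul_eq_mul]
  ring

theorem IsParallelOn.smul {V : ℝ → TangentBundle 𝓘(ℝ, E) M} {s : Set ℝ} (hV : IsParallelOn V s)
    (c : ℝ) :
    IsParallelOn (fun t => (⟨(V t).proj, c • (V t).2⟩ : TangentBundle 𝓘(ℝ, E) M)) s := by
  refine ⟨hV.1, fun t ht => ?_⟩
  obtain ⟨x₀, hx, a, b, ha, hb, h⟩ := hV.2 t ht
  refine ⟨x₀, hx, a, c • b, ha, ?_, fun w => ?_⟩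
  · simp only [fiberCoord_smul]
    exact hb.const_smul c
  · rw [fiberCoord_smul, chartMetric_smul_left, christoffel_smul, ← mul_add, h w, mul_zero]

/-! ### Pointed chains, difference chains and differential chains on a manifold -/

variable (E M)

/-- Pointed 1-chains: formal sums `∑ (pᵢ; vᵢ)` with `vᵢ ∈ Λ¹ T_{pᵢ}M = T_{pᵢ}M`, i.e. finitely
supported sections of the tangent bundle. They carry the 1-norm defined below. -/
def PointedOneChain : Type _ :=
  Π₀ x : M, TangentSpace 𝓘(ℝ, E) x

instance : AddCommGroup (PointedZeroChain E M) := inferInstanceAs (AddCommGroup (M →₀ ℝ))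
instance : Module ℝ (PointedZeroChain E M) := inferInstanceAs (Module ℝ (M →₀ ℝ))
instance : AddCommGroup (PointedOneChain E M) :=
  inferInstanceAs (AddCommGroup (Π₀ x : M, TangentSpace 𝓘(ℝ, E) x))
instance : Module ℝ (PointedOneChain E M) :=
  inferInstanceAs (Module ℝ (Π₀ x : M, TangentSpace 𝓘(ℝ, E) x))

variable {M}

/-- The 0-element `(p; a)`. -/
def zeroElement (p : M) (a : ℝ) : PointedZeroChain E M := Finsupp.single p a

open Classical in
/-- The 1-elements `(p; v)`, linear in `v ∈ T_pM`. -/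
def oneElementLinear (p : M) : TangentSpace 𝓘(ℝ, E) p →ₗ[ℝ] PointedOneChain E M :=
  DFinsupp.lsingle p

variable {E}

/-- The 1-element `(p; v)` given by the tangent vector `z = ⟨p, v⟩`. -/
def oneElement (z : TangentBundle 𝓘(ℝ, E) M) : PointedOneChain E M :=
  oneElementLinear E z.proj z.2

/-- `IsZeroDifference D w` says that `D = Δ^j_U(p; a)`, `j ≤ 2`, with `w = |Δ^j_U(p; a)|_j`.
* `j = 0`: `(p; a)`, of weight `|a|`;
* `j = 1`: `(exp_p u; a) - (p; a)`, of weight `‖u‖ |a|`; here `U` is the geodesic with initial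
  velocity `u`;
* `j = 2`: `(exp_q v'; a) - (q; a) - (exp_p v; a) + (p; a)`, of weight `‖u‖ ‖v‖ |a|`, where
  `q = exp_p u` and `v'` is the parallel transport of `v` to `q` along `U`; here `W` is the
  parallel field along `U` from `v` to `v'`, and `Y`, `Y'` are the geodesics with initial
  velocities `v` and `v'`. -/
inductive IsZeroDifference : PointedZeroChain E M → ℝ → Prop
  | order_zero (p : M) (a : ℝ) : IsZeroDifference (zeroElement E p a) |a|
  | order_one (U : ℝ → TangentBundle 𝓘(ℝ, E) M) (hU : IsGeodesicOn U (Icc 0 1)) (a : ℝ) :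
      IsZeroDifference (zeroElement E (U 1).proj a - zeroElement E (U 0).proj a)
        (‖(U 0).2‖ * |a|)
  | order_two (U W Y Y' : ℝ → TangentBundle 𝓘(ℝ, E) M)
      (hU : IsGeodesicOn U (Icc 0 1)) (hW : IsParallelOn W (Icc 0 1))
      (hY : IsGeodesicOn Y (Icc 0 1)) (hY' : IsGeodesicOn Y' (Icc 0 1))
      (hUW : ∀ t ∈ Icc (0 : ℝ) 1, (W t).proj = (U t).proj)
      (hWY : W 0 = Y 0) (hWY' : W 1 = Y' 0) (a : ℝ) :
      IsZeroDifference
        (zeroElement E (Y' 1).proj a - zeroElement E (U 1).proj a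
          - zeroElement E (Y 1).proj a + zeroElement E (U 0).proj a)
        (‖(U 0).2‖ * ‖(Y 0).2‖ * |a|)

/-- `IsOneDifference D w` says that `D = Δ^j_U(p; v)`, `j ≤ 1`, with `w = |Δ^j_U(p; v)|_j`.
* `j = 0`: `(p; v)`, of weight `‖v‖`;
* `j = 1`: `(exp_p u; v') - (p; v)`, of weight `‖u‖ ‖v‖`, where `v'` is the parallel transport
  of `v` to `exp_p u`; here `U` is the geodesic with initial velocity `u` and `V` is the parallel
  field along it from `v` to `v'`. -/
inductive IsOneDifference : PointedOneChain E M → ℝ → Prop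
  | order_zero (z : TangentBundle 𝓘(ℝ, E) M) : IsOneDifference (oneElement z) ‖z.2‖
  | order_one (U V : ℝ → TangentBundle 𝓘(ℝ, E) M)
      (hU : IsGeodesicOn U (Icc 0 1)) (hV : IsParallelOn V (Icc 0 1))
      (hUV : ∀ t ∈ Icc (0 : ℝ) 1, (V t).proj = (U t).proj) :
      IsOneDifference (oneElement (V 1) - oneElement (V 0)) (‖(U 0).2‖ * ‖(V 0).2‖)

theorem IsZeroDifference.nonneg (c : PointedZeroChain E M) (w : ℝ) (h : IsZeroDifference c w) :
    0 ≤ w := by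
  cases h <;> positivity

theorem IsOneDifference.nonneg (c : PointedOneChain E M) (w : ℝ) (h : IsOneDifference c w) :
    0 ≤ w := by
  cases h <;> positivity

theorem smul_zeroElement (c : ℝ) (p : M) (a : ℝ) :
    c • zeroElement E p a = zeroElement E p (c * a) :=
  Finsupp.smul_single c p a

theorem smul_oneElement (c : ℝ) (z : TangentBundle 𝓘(ℝ, E) M) :
    c • oneElement z = oneElement (⟨z.proj, c • z.2⟩ : TangentBundle 𝓘(ℝ, E) M) :=
  ((oneElementLinear E z.proj).map_smul c z.2).symm

theorem IsZeroDifference.smul (c : ℝ) (A : PointedZeroChain E M) (w : ℝ)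
    (h : IsZeroDifference A w) : IsZeroDifference (c • A) (|c| * w) := by
  cases h with
  | order_zero p a =>
    rw [smul_zeroElement, ← abs_mul]
    exact .order_zero p _
  | order_one U hU a =>
    rw [smul_sub, smul_zeroElement, smul_zeroElement, mul_left_comm, ← abs_mul]
    exact .order_one U hU _
  | order_two U W Y Y' hU hW hY hY' hUW hWY hWY' a =>
    rw [smul_add, smul_sub, smul_sub, smul_zeroElement, smul_zeroElement, smul_zeroElement,
      smul_zeroElement, mul_left_comm, ← abs_mul]
    exact .order_two U W Y Y' hU hW hY hY' hUW hWY hWY' _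

theorem IsOneDifference.smul (c : ℝ) (A : PointedOneChain E M) (w : ℝ)
    (h : IsOneDifference A w) : IsOneDifference (c • A) (|c| * w) := by
  cases h with
  | order_zero z =>
    rw [smul_oneElement, ← Real.norm_eq_abs, ← norm_smul]
    exact .order_zero _
  | order_one U V hU hV hUV =>
    rw [smul_sub, smul_oneElement, smul_oneElement, mul_left_comm, ← Real.norm_eq_abs,
      ← norm_smul]
    exact .order_one U (fun t => ⟨(V t).proj, c • (V t).2⟩) hU (hV.smul c) hUV

theorem costs_zero_nonempty (A : PointedZeroChain E M) :
    (costs (IsZeroDifference (E := E) (M := M)) A).Nonempty := by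
  induction A using Finsupp.induction with
  | zero => exact ⟨0, [], by simp, rfl, rfl⟩
  | single_add p a f _ _ hf =>
    obtain ⟨s, hs⟩ := hf
    refine ⟨_, costs_add (A := zeroElement E p a) (s := |a|) ?_ hs⟩
    exact ⟨[(zeroElement E p a, |a|)], by simpa using .order_zero p a, by simp, by simp⟩

open Classical in
theorem costs_one_nonempty (A : PointedOneChain E M) :
    (costs (IsOneDifference (E := E) (M := M)) A).Nonempty := by
  induction A using DFinsupp.induction with
  | h0 => exact ⟨0, [], by simp, rfl, rfl⟩
  | ha p v f _ _ hf =>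
    obtain ⟨s, hs⟩ := hf
    let z : TangentBundle 𝓘(ℝ, E) M := ⟨p, v⟩
    refine ⟨_, costs_add (A := oneElement z) (s := ‖z.2‖) ?_ hs⟩
    exact ⟨[(oneElement z, ‖z.2‖)], by simpa using .order_zero z, by simp, by simp⟩

variable (E M)

/-- The 2-norm on pointed 0-chains, `‖A‖ = inf {∑ |Δ^j_U(p; a)|_j : A = ∑ Δ^j_U(p; a), j ≤ 2}`. -/
def zeroChainNorm : Seminorm ℝ (PointedZeroChain E M) :=
  decompositionSeminorm IsZeroDifference IsZeroDifference.nonneg IsZeroDifference.smul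
    costs_zero_nonempty

/-- The 1-norm on pointed 1-chains, `‖A‖ = inf {∑ |Δ^j_U(p; v)|_j : A = ∑ Δ^j_U(p; v), j ≤ 1}`. -/
def oneChainNorm : Seminorm ℝ (PointedOneChain E M) :=
  decompositionSeminorm IsOneDifference IsOneDifference.nonneg IsOneDifference.smul
    costs_one_nonempty

instance : SeminormedAddCommGroup (PointedZeroChain E M) :=
  (zeroChainNorm E M).toAddGroupSeminorm.toSeminormedAddCommGroup
instance : NormedSpace ℝ (PointedZeroChain E M) where
  norm_smul_le c A := (map_smul_eq_mul (zeroChainNorm E M) c A).le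

instance : SeminormedAddCommGroup (PointedOneChain E M) :=
  (oneChainNorm E M).toAddGroupSeminorm.toSeminormedAddCommGroup
instance : NormedSpace ℝ (PointedOneChain E M) where
  norm_smul_le c A := (map_smul_eq_mul (oneChainNorm E M) c A).le

/-- Differential 0-chains of order 2 on `M`: the completion of the pointed 0-chains. -/
abbrev ZeroChain : Type _ := UniformSpace.Completion (PointedZeroChain E M)

/-- Differential 1-chains of order 1 on `M`: the completion of the pointed 1-chains. -/
abbrev OneChain : Type _ := UniformSpace.Completion (PointedOneChain E M)

variable {E M}

/-! ### Boundary -/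

/-- `K` is the prederivative `P_v(p; 1) = lim_{t → 0} ((exp_p (t v); 1/t) - (p; 1/t))` for
`z = ⟨p, v⟩`; here `exp_p (t v)` is the position at time `t` of the geodesic with initial
velocity `v`. -/
def IsPrederivative (z : TangentBundle 𝓘(ℝ, E) M) (K : ZeroChain E M) : Prop :=
  ∃ U : ℝ → TangentBundle 𝓘(ℝ, E) M, ∃ ε > 0, IsGeodesicOn U (Ioo (-ε) ε) ∧ U 0 = z ∧
    Tendsto (fun t : ℝ =>
        ((zeroElement E (U t).proj t⁻¹ - zeroElement E z.proj t⁻¹ : PointedZeroChain E M) :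
          ZeroChain E M))
      (𝓝[≠] 0) (𝓝 K)

/-- The prederivative `P_v(p; 1)`. -/
def prederivative (z : TangentBundle 𝓘(ℝ, E) M) : ZeroChain E M :=
  Classical.epsilon (IsPrederivative z)

open Classical in
/-- The boundary of a pointed 1-chain, `∂ ∑ (pᵢ; vᵢ) = ∑ P_{vᵢ}(pᵢ; 1)`. -/
def pointedBoundary (A : PointedOneChain E M) : ZeroChain E M :=
  DFinsupp.sum (β := fun x : M => TangentSpace 𝓘(ℝ, E) x) A fun p v => prederivative ⟨p, v⟩

/-- The boundary operator from 1-chains of order 1 to 0-chains of order 2: the extension by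
continuity of the boundary of pointed chains. -/
def boundary : OneChain E M → ZeroChain E M :=
  (UniformSpace.Completion.isDenseInducing_coe (α := PointedOneChain E M)).extend pointedBoundary

/-! ### Pushforward -/

variable {E' : Type*} [NormedAddCommGroup E'] [NormedSpace ℝ E']
  {N : Type*} [TopologicalSpace N] [ChartedSpace E' N] [IsManifold 𝓘(ℝ, E') ∞ N]
  [RiemannianBundle (fun x : N => TangentSpace 𝓘(ℝ, E') x)]

open Classical in
/-- Pushforward of pointed 1-chains, `F_* ∑ (pᵢ; vᵢ) = ∑ (F pᵢ; dF_{pᵢ} vᵢ)`. -/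
def pointedPushforward (F : N → M) : PointedOneChain E' N →ₗ[ℝ] PointedOneChain E M :=
  DFinsupp.lsum (M := fun x : N => TangentSpace 𝓘(ℝ, E') x) ℝ fun p =>
    (oneElementLinear E (F p)).comp (mfderiv 𝓘(ℝ, E') 𝓘(ℝ, E) F p).toLinearMap

/-- Pushforward of 1-chains of order 1: the extension by continuity of the pushforward of pointed
chains. -/
def pushforward (F : N → M) : OneChain E' N → OneChain E M :=
  (UniformSpace.Completion.isDenseInducing_coe (α := PointedOneChain E' N)).extend
    fun A => (pointedPushforward (E := E) F A : OneChain E M)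

/-! ### The interval, the chains `J_T`, quasi-regular points -/

/-- The `n`-th binary subdivision of `[0, T]` as a pointed 1-chain on `ℝ`: the sum of the elements
`(pᵢ; 2⁻ⁿ T)` over the midpoints `pᵢ` of the `2ⁿ` subintervals. -/
def intervalApprox (T : ℝ) (n : ℕ) : PointedOneChain ℝ ℝ :=
  ∑ i ∈ Finset.range (2 ^ n),
    oneElementLinear ℝ (((i : ℝ) + 1 / 2) * (T / 2 ^ n)) (T / 2 ^ n : ℝ)

/-- The differential 1-chain on `ℝ` associated to the interval `[0, T]`. -/
def intervalChain (T : ℝ) : OneChain ℝ ℝ :=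
  limUnder atTop fun n => (intervalApprox T n : OneChain ℝ ℝ)

/-- The normalized orbit chain `J_T = (1/T) φ_* [0, T]`. -/
def orbitChain (φ : ℝ → M) (T : ℝ) : OneChain E M :=
  T⁻¹ • pushforward φ (intervalChain T)

end Riemannian

/-- Quasi-regularity of the point whose orbit is `φ`: all continuous functions have a time
average along `φ`. -/
def IsQuasiRegular {M : Type*} [TopologicalSpace M] (φ : ℝ → M) : Prop :=
  ∀ f : C(M, ℝ), ∃ L : ℝ, Tendsto (fun T : ℝ => T⁻¹ * ∫ t in (0 : ℝ)..T, f (φ t)) atTop (𝓝 L)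

end DifferentialChain

end

/-! The proof turns everything into a Bochner integral in the Banach space of 1-chains. Since `[0,
T]` is the integral of the elements `(t; 1)` and pushforward along the orbit is a bounded operator
sending `(t; 1)` to `(φ t; X (φ t))`, one gets `J_T = T⁻¹ ∫₀ᵀ (φ t; X (φ t)) dt` (`orbitChain_eq`).
The Lipschitz condition on `X` makes `q ↦ (q; X q)` continuous into the 1-chains, so `J_T` is the
time average of a continuous Banach-valued function on a compact space. A partition of unity
approximates that function uniformly by finite sums `∑ ρᵢ • gᵢ` with scalar `ρᵢ`; quasi-regularity
gives averages of the `ρᵢ`, and the averages `J_T` are Cauchy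
(`IsQuasiRegular.exists_tendsto_average`).

For the boundary, `∂(p; v)` is the derivative of `t ↦ (γ t; 1)` along every curve `γ` with velocity
`v` at `p` (`hasDerivAt_pointChain`). The fundamental theorem of calculus gives `∂J_T = T⁻¹ ((φ T;
1) - (φ 0; 1))`, of norm at most `2 / T`, and `∂` is continuous.

Most of the work is to show that the operators are what they should be. `boundary` and `pushforward`
are defined through dense extension, which is meaningful once the maps on pointed chains are linear
and bounded, and `prederivative` is a choice, which is meaningful once the limit exists and is
unique. Linear maps are bounded by testing them on difference elements. Existence of the
prederivative comes from bounded second differences, its additivity from Lipschitz dependence on the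
base point. The estimates in charts rest on short geodesics joining any two nearby points and on
parallel transport along them. -/

noncomputable section

set_option linter.unusedSectionVars false
set_option maxSynthPendingDepth 3

namespace DifferentialChain

/-! ### Coordinates on the tangent bundle given by a chart. -/

section ChartFrame

variable {E : Type*} [NormedAddCommGroup E] [NormedSpace ℝ E]
  {M : Type*} [TopologicalSpace M] [ChartedSpace E M] [IsManifold 𝓘(ℝ, E) ∞ M]

/-- The tangent vector at the point with coordinates `y` in the chart at `x₀` whose coordinates
in the frame of this chart are `v`. -/
def tangentOfCoord (x₀ : M) (y v : E) : TangentBundle 𝓘(ℝ, E) M :=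
  ⟨(extChartAt 𝓘(ℝ, E) x₀).symm y,
    (trivializationAt E (TangentSpace 𝓘(ℝ, E)) x₀).symmL ℝ ((extChartAt 𝓘(ℝ, E) x₀).symm y) v⟩

theorem extChartAt_symm_mem_chart_source {x₀ : M} {y : E}
    (hy : y ∈ (extChartAt 𝓘(ℝ, E) x₀).target) :
    (extChartAt 𝓘(ℝ, E) x₀).symm y ∈ (chartAt E x₀).source := by
  rw [← extChartAt_source 𝓘(ℝ, E)]
  exact (extChartAt 𝓘(ℝ, E) x₀).map_target hy

theorem mem_baseSet_of_mem_target {x₀ : M} {y : E} (hy : y ∈ (extChartAt 𝓘(ℝ, E) x₀).target) :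
    (extChartAt 𝓘(ℝ, E) x₀).symm y ∈
      (trivializationAt E (TangentSpace 𝓘(ℝ, E) (M := M)) x₀).baseSet := by
  rw [TangentBundle.trivializationAt_baseSet]
  exact extChartAt_symm_mem_chart_source hy

theorem fiberCoord_tangentOfCoord {x₀ : M} {y : E} (hy : y ∈ (extChartAt 𝓘(ℝ, E) x₀).target)
    (v : E) : fiberCoord x₀ (tangentOfCoord x₀ y v) = v := by
  have hb := mem_baseSet_of_mem_target hy
  have := (trivializationAt E (TangentSpace 𝓘(ℝ, E)) x₀).apply_mk_symm hb v
  simp only [fiberCoord, tangentOfCoord]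
  rw [Trivialization.symmL_apply _ hb]
  exact congrArg Prod.snd this

theorem tangentOfCoord_fiberCoord {x₀ : M} {z : TangentBundle 𝓘(ℝ, E) M}
    (hz : z.proj ∈ (chartAt E x₀).source) :
    tangentOfCoord x₀ (extChartAt 𝓘(ℝ, E) x₀ z.proj) (fiberCoord x₀ z) = z := by
  obtain ⟨q, v⟩ := z
  have hq : (extChartAt 𝓘(ℝ, E) x₀).symm (extChartAt 𝓘(ℝ, E) x₀ q) = q :=
    (extChartAt 𝓘(ℝ, E) x₀).left_inv (by rw [extChartAt_source]; exact hz)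
  simp only [tangentOfCoord, fiberCoord]
  rw [hq]
  congr 1
  rw [Trivialization.symmL_apply _ (by rw [TangentBundle.trivializationAt_baseSet]; exact hz)]
  exact (trivializationAt E (TangentSpace 𝓘(ℝ, E)) x₀).symm_proj_apply ⟨q, v⟩
    (by rw [TangentBundle.trivializationAt_baseSet]; exact hz)

theorem hasMFDerivAt_extChartAt_symm {x₀ : M} {y : E}
    (hy : y ∈ (extChartAt 𝓘(ℝ, E) x₀).target) :
    HasMFDerivAt 𝓘(ℝ, E) 𝓘(ℝ, E) (extChartAt 𝓘(ℝ, E) x₀).symm y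
      ((trivializationAt E (TangentSpace 𝓘(ℝ, E)) x₀).symmL ℝ
        ((extChartAt 𝓘(ℝ, E) x₀).symm y)) := by
  have h := mdifferentiableWithinAt_extChartAt_symm (I := 𝓘(ℝ, E)) hy
  have h2 := h.hasMFDerivWithinAt
  have h3 := TangentBundle.symmL_trivializationAt (I := 𝓘(ℝ, E))
    (extChartAt_symm_mem_chart_source hy)
  rw [(extChartAt 𝓘(ℝ, E) x₀).right_inv hy] at h3
  rw [h3]
  simpa [hasMFDerivWithinAt_univ] using h2

theorem HasDerivWithinAt.hasMFDerivWithinAt_extChartAt_symm {x₀ : M} {c : ℝ → E} {a : E}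
    {s : Set ℝ} {t : ℝ} (hc : HasDerivWithinAt c a s t)
    (ht : c t ∈ (extChartAt 𝓘(ℝ, E) x₀).target) :
    HasMFDerivWithinAt 𝓘(ℝ, ℝ) 𝓘(ℝ, E) (fun τ => (extChartAt 𝓘(ℝ, E) x₀).symm (c τ)) s t
      ((1 : ℝ →L[ℝ] ℝ).smulRight (tangentOfCoord x₀ (c t) a).2) := by
  have h1 := (hasMFDerivAt_extChartAt_symm ht).comp_hasMFDerivWithinAt t
    hc.hasFDerivWithinAt.hasMFDerivWithinAt
  exact h1.congr_mfderiv (ContinuousLinearMap.ext fun r : ℝ =>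
    map_smul ((trivializationAt E (TangentSpace 𝓘(ℝ, E)) x₀).symmL ℝ
      ((extChartAt 𝓘(ℝ, E) x₀).symm (c t))) r a)

end ChartFrame

/-! ### Smoothness of the metric in a chart. -/

section Metric

variable {E : Type*} [NormedAddCommGroup E] [NormedSpace ℝ E]
  {M : Type*} [TopologicalSpace M] [ChartedSpace E M] [IsManifold 𝓘(ℝ, E) ∞ M]
  [RiemannianBundle (fun x : M => TangentSpace 𝓘(ℝ, E) x)]
  [IsContMDiffRiemannianBundle 𝓘(ℝ, E) ∞ E (fun x : M => TangentSpace 𝓘(ℝ, E) x)]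

omit [IsContMDiffRiemannianBundle 𝓘(ℝ, E) ∞ E (fun x : M => TangentSpace 𝓘(ℝ, E) x)] in
theorem chartMetric_self_eq_zero {x₀ : M} {y v : E} (hy : y ∈ (extChartAt 𝓘(ℝ, E) x₀).target)
    (h : chartMetric x₀ y v v = 0) : v = 0 := by
  rw [chartMetric] at h
  have h0 := inner_self_eq_zero.1 h
  have h1 := fiberCoord_tangentOfCoord hy v
  rw [← h1, tangentOfCoord, h0]
  have := fiberCoord_smul x₀ 0 (⟨(extChartAt 𝓘(ℝ, E) x₀).symm y, 0⟩ : TangentBundle 𝓘(ℝ, E) M)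
  rwa [smul_zero, zero_smul] at this

/-- Read in the trivialization at `x₀`, the fibre component is the constant `v`. -/
theorem contMDiffOn_tangentOfCoord (x₀ : M) (v : E) :
    ContMDiffOn 𝓘(ℝ, E) 𝓘(ℝ, E).tangent ∞ (fun y => tangentOfCoord x₀ y v)
      (extChartAt 𝓘(ℝ, E) x₀).target := by
  intro y hy
  have hb := mem_baseSet_of_mem_target hy
  refine ((trivializationAt E (TangentSpace 𝓘(ℝ, E)) x₀).contMDiffWithinAt_iff ?_).2 ⟨?_, ?_⟩
  · exact (Trivialization.mem_source _).2 hb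
  · exact (contMDiffOn_extChartAt_symm x₀) y hy
  · refine contMDiffWithinAt_const (c := v) |>.congr (fun z hz => ?_) ?_
    · exact fiberCoord_tangentOfCoord hz v
    · exact fiberCoord_tangentOfCoord hy v

theorem contDiffOn_chartMetric (x₀ : M) (v w : E) :
    ContDiffOn ℝ ∞ (fun y => chartMetric x₀ y v w) (extChartAt 𝓘(ℝ, E) x₀).target := by
  rw [← contMDiffOn_iff_contDiffOn]
  exact ContMDiffOn.inner_bundle (E := fun x : M => TangentSpace 𝓘(ℝ, E) x) (IB := 𝓘(ℝ, E))
    (F := E) (b := fun y => (extChartAt 𝓘(ℝ, E) x₀).symm y)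
    (v := fun y => (tangentOfCoord x₀ y v).2) (w := fun y => (tangentOfCoord x₀ y w).2)
    (contMDiffOn_tangentOfCoord x₀ v) (contMDiffOn_tangentOfCoord x₀ w)

end Metric

/-! ### The equation of parallel transport solved for the derivative. -/

section Christoffel

variable {E : Type*} [NormedAddCommGroup E] [NormedSpace ℝ E] [FiniteDimensional ℝ E]
  {M : Type*} [TopologicalSpace M] [ChartedSpace E M] [IsManifold 𝓘(ℝ, E) ∞ M]
  [RiemannianBundle (fun x : M => TangentSpace 𝓘(ℝ, E) x)]

/-- The Riemannian metric in the chart at `x₀` as a continuous bilinear form. -/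
def chartMetricL (x₀ : M) (y : E) : E →L[ℝ] E →L[ℝ] ℝ :=
  LinearMap.toContinuousLinearMap
    (LinearMap.toContinuousLinearMap.toLinearMap ∘ₗ
      (LinearMap.mk₂ ℝ (chartMetric x₀ y)
        (fun u v w => by simp only [chartMetric, map_add]; rw [inner_add_left])
        (fun c u v => by rw [chartMetric_smul_left, smul_eq_mul])
        (fun u v w => by simp only [chartMetric, map_add]; rw [inner_add_right])
        (fun c u v => by rw [chartMetric_smul_right, smul_eq_mul])))

theorem chartMetricL_apply (x₀ : M) (y v w : E) :
    chartMetricL x₀ y v w = chartMetric x₀ y v w := rfl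

/-- Definiteness makes the form injective, and `E` and its dual have the same finite dimension.
Inverting the form is what turns the weak equation `⟨V', w⟩ + ⟨Γ(γ', V), w⟩ = 0` into an explicit
ODE. -/
theorem exists_continuousLinearEquiv_eq_chartMetricL {x₀ : M} {y : E}
    (hy : y ∈ (extChartAt 𝓘(ℝ, E) x₀).target) :
    ∃ e : E ≃L[ℝ] (E →L[ℝ] ℝ), (e : E →L[ℝ] E →L[ℝ] ℝ) = chartMetricL x₀ y := by
  have hinj : Function.Injective (chartMetricL x₀ y).toLinearMap := by
    rw [← LinearMap.ker_eq_bot, LinearMap.ker_eq_bot']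
    intro v hv
    refine chartMetric_self_eq_zero hy ?_
    rw [← chartMetricL_apply]
    exact congrArg (fun f : E →L[ℝ] ℝ => f v) hv
  have hdim : Module.finrank ℝ E = Module.finrank ℝ (E →L[ℝ] ℝ) := by
    rw [← (LinearMap.toContinuousLinearMap (𝕜 := ℝ) (E := E) (F' := ℝ)).finrank_eq]
    exact (Subspace.dual_finrank_eq (K := ℝ) (V := E)).symm
  refine ⟨(LinearEquiv.ofInjectiveOfFinrankEq _ hinj hdim).toContinuousLinearEquiv, ?_⟩
  ext v w
  rfl

variable [IsContMDiffRiemannianBundle 𝓘(ℝ, E) ∞ E (fun x : M => TangentSpace 𝓘(ℝ, E) x)]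

theorem contDiffOn_chartMetricL (x₀ : M) :
    ContDiffOn ℝ ∞ (chartMetricL x₀) (extChartAt 𝓘(ℝ, E) x₀).target :=
  contDiffOn_clm_apply.2 fun v => contDiffOn_clm_apply.2 fun w => contDiffOn_chartMetric x₀ v w

theorem fderiv_chartMetric {x₀ : M} {y : E} (hy : y ∈ (extChartAt 𝓘(ℝ, E) x₀).target)
    (u v w : E) :
    fderiv ℝ (fun z => chartMetric x₀ z v w) y u = fderiv ℝ (chartMetricL x₀) y u v w := by
  have hd : DifferentiableAt ℝ (chartMetricL x₀) y :=
    ((contDiffOn_chartMetricL x₀).contDiffAt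
      ((isOpen_extChartAt_target (I := 𝓘(ℝ, E)) x₀).mem_nhds hy)).differentiableAt (by simp)
  have h := ((hd.hasFDerivAt.clm_apply (hasFDerivAt_const v y)).clm_apply
    (hasFDerivAt_const w y)).fderiv
  have h' : (fun z => chartMetric x₀ z v w) = fun z => chartMetricL x₀ z v w := rfl
  rw [h', h]
  simp

set_option synthInstance.maxHeartbeats 200000 in
set_option maxHeartbeats 800000 in
/-- In coordinates, parallel transport solves `V' = B(γ', V)` with a `C¹` bilinear `B`. -/
theorem exists_transport_operator (x₀ : M) :
    ∃ B : E → E →L[ℝ] E →L[ℝ] E,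
      ContDiffOn ℝ 1 B (extChartAt 𝓘(ℝ, E) x₀).target ∧
      ∀ y ∈ (extChartAt 𝓘(ℝ, E) x₀).target, ∀ a v w,
        chartMetric x₀ y (B y a v) w + christoffel x₀ y a v w = 0 := by
  -- `fl'` swaps the first two arguments of a trilinear form, and composing with `fl` swaps the last
  -- two. So `D y`, `fl' (D y)` and `fl.comp (fl' (D y))` at `(a, v, w)` are the three derivatives
  -- in the Christoffel symbol, `Γ` is its negative, and `B` raises the last index with the inverse
  -- metric.
  let fl : (E →L[ℝ] E →L[ℝ] ℝ) →L[ℝ] (E →L[ℝ] E →L[ℝ] ℝ) :=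
    (ContinuousLinearMap.flipₗᵢ ℝ E E ℝ).toContinuousLinearEquiv.toContinuousLinearMap
  let fl' : (E →L[ℝ] E →L[ℝ] E →L[ℝ] ℝ) →L[ℝ] (E →L[ℝ] E →L[ℝ] E →L[ℝ] ℝ) :=
    (ContinuousLinearMap.flipₗᵢ ℝ E E (E →L[ℝ] ℝ)).toContinuousLinearEquiv.toContinuousLinearMap
  let D : E → E →L[ℝ] E →L[ℝ] E →L[ℝ] ℝ := fderiv ℝ (chartMetricL x₀)
  let Γ : E → E →L[ℝ] E →L[ℝ] E →L[ℝ] ℝ := fun y =>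
    (-(1 / 2) : ℝ) • (D y + fl' (D y) - fl.comp (fl' (D y)))
  let B : E → E →L[ℝ] E →L[ℝ] E := fun y =>
    (ContinuousLinearMap.compL ℝ E (E →L[ℝ] ℝ) E (chartMetricL x₀ y).inverse).comp (Γ y)
  have ho := isOpen_extChartAt_target (I := 𝓘(ℝ, E)) x₀
  refine ⟨B, ?_, ?_⟩
  · have hD : ContDiffOn ℝ 1 D (extChartAt 𝓘(ℝ, E) x₀).target :=
      (contDiffOn_chartMetricL x₀).fderiv_of_isOpen ho
        (WithTop.coe_le_coe.2 (le_top : (1 + 1 : ℕ∞) ≤ ⊤))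
    have hΓ : ContDiffOn ℝ 1 Γ (extChartAt 𝓘(ℝ, E) x₀).target := by
      have h1 : ContDiffOn ℝ 1 (fun y => fl' (D y)) (extChartAt 𝓘(ℝ, E) x₀).target :=
        fl'.contDiff.comp_contDiffOn hD
      exact ((hD.add h1).sub (contDiffOn_const.clm_comp h1)).const_smul _
    refine ContDiffOn.clm_comp ?_ hΓ
    refine (ContinuousLinearMap.contDiff _).comp_contDiffOn ?_
    intro y hy
    obtain ⟨e, he⟩ := exists_continuousLinearEquiv_eq_chartMetricL hy
    have h1 : ContDiffAt ℝ 1 ContinuousLinearMap.inverse (chartMetricL x₀ y) := by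
      rw [← he]
      exact contDiffAt_map_inverse e
    exact h1.comp_contDiffWithinAt y
      (((contDiffOn_chartMetricL x₀).of_le (by exact_mod_cast le_top)) y hy)
  · intro y hy a v w
    obtain ⟨e, he⟩ := exists_continuousLinearEquiv_eq_chartMetricL hy
    have h1 : chartMetric x₀ y (B y a v) w = Γ y a v w := by
      have h2 : B y a v = e.symm (Γ y a v) := by
        simp only [B, ← he, ContinuousLinearMap.inverse_equiv]
        rfl
      rw [← chartMetricL_apply, h2, ← he]
      simp
    rw [h1, christoffel, fderiv_chartMetric hy, fderiv_chartMetric hy, fderiv_chartMetric hy]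
    have h3 : Γ y a v w = (-(1 / 2) : ℝ) * (D y a v w + D y v a w - D y w a v) := rfl
    rw [h3]
    ring

end Christoffel

/-! ### Affine reparametrization, and fields built from solutions of coordinate ODEs. -/

section Transport

variable {E : Type*} [NormedAddCommGroup E] [NormedSpace ℝ E]
  {M : Type*} [TopologicalSpace M] [ChartedSpace E M] [IsManifold 𝓘(ℝ, E) ∞ M]
  [RiemannianBundle (fun x : M => TangentSpace 𝓘(ℝ, E) x)]

/-- The tangent vector `c • z`, at the same point. -/
def scaleTangent (c : ℝ) (z : TangentBundle 𝓘(ℝ, E) M) : TangentBundle 𝓘(ℝ, E) M :=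
  ⟨z.proj, c • z.2⟩

@[simp]
theorem scaleTangent_proj (c : ℝ) (z : TangentBundle 𝓘(ℝ, E) M) :
    (scaleTangent c z).proj = z.proj := rfl

theorem norm_scaleTangent (c : ℝ) (z : TangentBundle 𝓘(ℝ, E) M) :
    ‖(scaleTangent c z).2‖ = |c| * ‖z.2‖ := by
  rw [← Real.norm_eq_abs]
  exact norm_smul c z.2

theorem christoffel_smul_left (x₀ : M) (y : E) (c : ℝ) (u v w : E) :
    christoffel x₀ y (c • u) v w = c * christoffel x₀ y u v w := by
  have h (f : E → ℝ) (x : E) : fderiv ℝ (fun z => c * f z) x = c • fderiv ℝ f x :=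
    congrFun (fderiv_const_smul_field (f := f) c) x
  simp only [christoffel, chartMetric_smul_left, h, map_smul, smul_apply, smul_eq_mul]
  ring

theorem hasDerivWithinAt_comp_affine {F : Type*} [NormedAddCommGroup F] [NormedSpace ℝ F]
    {f : ℝ → F} {f' : F} {s s' : Set ℝ} {a c t : ℝ} (hf : HasDerivWithinAt f f' s (a + c * t))
    (hs : MapsTo (fun τ => a + c * τ) s' s) :
    HasDerivWithinAt (fun τ => f (a + c * τ)) (c • f') s' t := by
  have h : HasDerivWithinAt (fun τ : ℝ => a + c * τ) c s' t := by
    simpa using (((hasDerivAt_id t).const_mul c).const_add a).hasDerivWithinAt (s := s')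
  exact hf.scomp t h hs

/-- Both `V'` and `Γ(γ', V)` acquire the factor `c`, so the equation survives. -/
theorem IsParallelOn.comp_affine {V : ℝ → TangentBundle 𝓘(ℝ, E) M} {s s' : Set ℝ}
    (hV : IsParallelOn V s) {a c : ℝ} (hs : MapsTo (fun τ => a + c * τ) s' s) :
    IsParallelOn (fun t => V (a + c * t)) s' := by
  refine ⟨hV.1.comp (by fun_prop) hs, fun t ht => ?_⟩
  obtain ⟨x₀, hx, a', b, ha, hb, h⟩ := hV.2 _ (hs ht)
  refine ⟨x₀, hx, c • a', c • b, hasDerivWithinAt_comp_affine ha hs,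
    hasDerivWithinAt_comp_affine hb hs, fun w => ?_⟩
  rw [chartMetric_smul_left, christoffel_smul_left, ← mul_add, h w, mul_zero]

theorem IsGeodesicOn.comp_affine {U : ℝ → TangentBundle 𝓘(ℝ, E) M} {s s' : Set ℝ}
    (hU : IsGeodesicOn U s) {a c : ℝ} (hs : MapsTo (fun τ => a + c * τ) s' s) :
    IsGeodesicOn (fun t => scaleTangent c (U (a + c * t))) s' := by
  refine ⟨(hU.1.comp_affine hs).smul c, fun t ht => ?_⟩
  have h : HasDerivWithinAt (fun τ : ℝ => a + c * τ) c s' t := by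
    simpa using (((hasDerivAt_id t).const_mul c).const_add a).hasDerivWithinAt (s := s')
  have h1 := (hU.2 _ (hs ht)).comp t h.hasFDerivWithinAt.hasMFDerivWithinAt hs
  refine h1.congr_mfderiv (ContinuousLinearMap.ext fun r : ℝ => ?_)
  exact mul_smul r c (U (a + c * t)).2

/-- `B` is the operator of parallel transport in the chart at `x₀`. -/
def IsTransportOperator (x₀ : M) (B : E → E →L[ℝ] E →L[ℝ] E) : Prop :=
  ∀ y ∈ (extChartAt 𝓘(ℝ, E) x₀).target, ∀ a v w,
    chartMetric x₀ y (B y a v) w + christoffel x₀ y a v w = 0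

theorem IsTransportOperator.isParallelOn {x₀ : M} {B : E → E →L[ℝ] E →L[ℝ] E}
    (hB : IsTransportOperator x₀ B) {c c' V : ℝ → E} {s : Set ℝ}
    (hs : MapsTo c s (extChartAt 𝓘(ℝ, E) x₀).target)
    (hc : ∀ t ∈ s, HasDerivWithinAt c (c' t) s t)
    (hV : ∀ t ∈ s, HasDerivWithinAt V (B (c t) (c' t) (V t)) s t) :
    IsParallelOn (fun t => tangentOfCoord x₀ (c t) (V t)) s := by
  have hright (t : ℝ) (ht : t ∈ s) : extChartAt 𝓘(ℝ, E) x₀ (tangentOfCoord x₀ (c t) (V t)).proj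
      = c t := (extChartAt 𝓘(ℝ, E) x₀).right_inv (hs ht)
  have hfib (t : ℝ) (ht : t ∈ s) : fiberCoord x₀ (tangentOfCoord x₀ (c t) (V t)) = V t :=
    fiberCoord_tangentOfCoord (hs ht) _
  refine ⟨(continuousOn_extChartAt_symm x₀).comp (fun t ht => (hc t ht).continuousWithinAt) hs,
    fun t ht => ⟨x₀, extChartAt_symm_mem_chart_source (hs ht), c' t, B (c t) (c' t) (V t),
      (hc t ht).congr hright (hright t ht), (hV t ht).congr hfib (hfib t ht), fun w => ?_⟩⟩
  rw [hright t ht, hfib t ht]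
  exact hB _ (hs ht) _ _ _

/-- A geodesic is the case where the transported field is the velocity `c'` itself. -/
theorem IsTransportOperator.isGeodesicOn {x₀ : M} {B : E → E →L[ℝ] E →L[ℝ] E}
    (hB : IsTransportOperator x₀ B) {c c' : ℝ → E} {s : Set ℝ}
    (hs : MapsTo c s (extChartAt 𝓘(ℝ, E) x₀).target)
    (hc : ∀ t ∈ s, HasDerivWithinAt c (c' t) s t)
    (hc' : ∀ t ∈ s, HasDerivWithinAt c' (B (c t) (c' t) (c' t)) s t) :
    IsGeodesicOn (fun t => tangentOfCoord x₀ (c t) (c' t)) s :=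
  ⟨hB.isParallelOn hs hc hc', fun t ht =>
    HasDerivWithinAt.hasMFDerivWithinAt_extChartAt_symm (hc t ht) (hs ht)⟩

end Transport

/-! ### A boundary value problem and a linear initial value problem, by contraction. -/

section ODE

variable {E : Type*} [NormedAddCommGroup E] [NormedSpace ℝ E]

/-- The primitive vanishing at `0` of a continuous function on `[0, 1]`, extended by constants. -/
def primitive (w : C(Icc (0 : ℝ) 1, E)) (t : ℝ) : E :=
  ∫ s in (0 : ℝ)..t, IccExtend zero_le_one w s

theorem continuous_iccExtend (w : C(Icc (0 : ℝ) 1, E)) :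
    Continuous (IccExtend (zero_le_one (α := ℝ)) w) :=
  w.continuous.Icc_extend'

theorem norm_iccExtend_le (w : C(Icc (0 : ℝ) 1, E)) (s : ℝ) :
    ‖IccExtend (zero_le_one (α := ℝ)) w s‖ ≤ ‖w‖ :=
  w.norm_coe_le_norm _

theorem norm_primitive_le (w : C(Icc (0 : ℝ) 1, E)) {t : ℝ} (ht : t ∈ Icc (0 : ℝ) 1) :
    ‖primitive w t‖ ≤ ‖w‖ := by
  have h := intervalIntegral.norm_integral_le_of_norm_le_const (a := 0) (b := t)
    (fun s _ => norm_iccExtend_le w s)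
  have h2 : |t - 0| ≤ 1 := by rw [sub_zero, abs_of_nonneg ht.1]; exact ht.2
  exact h.trans (mul_le_of_le_one_right (norm_nonneg _) h2)

theorem primitive_sub (w₁ w₂ : C(Icc (0 : ℝ) 1, E)) (t : ℝ) :
    primitive (w₁ - w₂) t = primitive w₁ t - primitive w₂ t := by
  rw [primitive, primitive, primitive, ← intervalIntegral.integral_sub
    ((continuous_iccExtend w₁).intervalIntegrable _ _)
    ((continuous_iccExtend w₂).intervalIntegrable _ _)]
  rfl

variable [CompleteSpace E]

theorem hasDerivAt_integral_of_continuous {f : ℝ → E} (hf : Continuous f) (t : ℝ) :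
    HasDerivAt (fun τ => ∫ s in (0 : ℝ)..τ, f s) (f t) t :=
  (hf.integral_hasStrictDerivAt 0 t).hasDerivAt

theorem hasDerivAt_primitive (w : C(Icc (0 : ℝ) 1, E)) (t : ℝ) :
    HasDerivAt (primitive w) (IccExtend zero_le_one w t) t :=
  hasDerivAt_integral_of_continuous (continuous_iccExtend w) t

theorem continuous_primitive (w : C(Icc (0 : ℝ) 1, E)) : Continuous (primitive w) :=
  continuous_iff_continuousAt.2 fun t => (hasDerivAt_primitive w t).continuousAt

/-- The primitive of mean `0` on `[0, 1]`. -/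
def centeredPrimitive (w : C(Icc (0 : ℝ) 1, E)) (t : ℝ) : E :=
  primitive w t - ∫ s in (0 : ℝ)..1, primitive w s

theorem norm_centeredPrimitive_le (w : C(Icc (0 : ℝ) 1, E)) {t : ℝ} (ht : t ∈ Icc (0 : ℝ) 1) :
    ‖centeredPrimitive w t‖ ≤ 2 * ‖w‖ := by
  have h : ‖∫ s in (0 : ℝ)..1, primitive w s‖ ≤ ‖w‖ * |1 - 0| := by
    refine intervalIntegral.norm_integral_le_of_norm_le_const fun s hs => ?_
    rw [uIoc_of_le zero_le_one] at hs
    exact norm_primitive_le w ⟨hs.1.le, hs.2⟩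
  rw [sub_zero, abs_one, mul_one] at h
  have := norm_sub_le (primitive w t) (∫ s in (0 : ℝ)..1, primitive w s)
  have := norm_primitive_le w ht
  rw [centeredPrimitive]
  linarith

theorem centeredPrimitive_sub (w₁ w₂ : C(Icc (0 : ℝ) 1, E)) (t : ℝ) :
    centeredPrimitive (w₁ - w₂) t = centeredPrimitive w₁ t - centeredPrimitive w₂ t := by
  simp only [centeredPrimitive, primitive_sub]
  rw [intervalIntegral.integral_sub ((continuous_primitive w₁).intervalIntegrable _ _)
    ((continuous_primitive w₂).intervalIntegrable _ _)]
  abel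

theorem hasDerivAt_centeredPrimitive (w : C(Icc (0 : ℝ) 1, E)) (t : ℝ) :
    HasDerivAt (centeredPrimitive w) (IccExtend zero_le_one w t) t :=
  (hasDerivAt_primitive w t).sub_const _

theorem continuous_centeredPrimitive (w : C(Icc (0 : ℝ) 1, E)) :
    Continuous (centeredPrimitive w) :=
  (continuous_primitive w).sub continuous_const

/-- The second primitive vanishing at `0` and `1`. -/
def greenPrimitive (w : C(Icc (0 : ℝ) 1, E)) (t : ℝ) : E :=
  ∫ s in (0 : ℝ)..t, centeredPrimitive w s

theorem hasDerivAt_greenPrimitive (w : C(Icc (0 : ℝ) 1, E)) (t : ℝ) :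
    HasDerivAt (greenPrimitive w) (centeredPrimitive w t) t :=
  hasDerivAt_integral_of_continuous (continuous_centeredPrimitive w) t

theorem continuous_greenPrimitive (w : C(Icc (0 : ℝ) 1, E)) : Continuous (greenPrimitive w) :=
  continuous_iff_continuousAt.2 fun t => (hasDerivAt_greenPrimitive w t).continuousAt

theorem greenPrimitive_zero (w : C(Icc (0 : ℝ) 1, E)) : greenPrimitive w 0 = 0 := by
  simp [greenPrimitive]

theorem greenPrimitive_one (w : C(Icc (0 : ℝ) 1, E)) : greenPrimitive w 1 = 0 := by
  simp only [greenPrimitive, centeredPrimitive]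
  rw [intervalIntegral.integral_sub ((continuous_primitive w).intervalIntegrable _ _) (by simp)]
  simp

theorem greenPrimitive_sub (w₁ w₂ : C(Icc (0 : ℝ) 1, E)) (t : ℝ) :
    greenPrimitive (w₁ - w₂) t = greenPrimitive w₁ t - greenPrimitive w₂ t := by
  simp only [greenPrimitive, centeredPrimitive_sub]
  rw [intervalIntegral.integral_sub ((continuous_centeredPrimitive w₁).intervalIntegrable _ _)
    ((continuous_centeredPrimitive w₂).intervalIntegrable _ _)]

theorem norm_greenPrimitive_le (w : C(Icc (0 : ℝ) 1, E)) {t : ℝ} (ht : t ∈ Icc (0 : ℝ) 1) :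
    ‖greenPrimitive w t‖ ≤ 2 * ‖w‖ := by
  have h : ‖∫ s in (0 : ℝ)..t, centeredPrimitive w s‖ ≤ (2 * ‖w‖) * |t - 0| := by
    refine intervalIntegral.norm_integral_le_of_norm_le_const fun s hs => ?_
    rw [uIoc_of_le ht.1] at hs
    exact norm_centeredPrimitive_le w ⟨hs.1.le, hs.2.trans ht.2⟩
  have h2 : |t - 0| ≤ 1 := by rw [sub_zero, abs_of_nonneg ht.1]; exact ht.2
  exact h.trans (mul_le_of_le_one_right (by positivity) h2)

/-- Change the operator first, then one argument at a time. This is the contraction estimate for the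
quadratic right-hand side of the geodesic equation. -/
theorem norm_bilinear_sub_le {B₁ B₂ : E →L[ℝ] E →L[ℝ] E} {d₁ d₂ : E} {L r β δ : ℝ} (hL : 0 ≤ L)
    (hr : 0 ≤ r) (hB₂ : ‖B₂‖ ≤ L) (hB : ‖B₁ - B₂‖ ≤ β) (h₁ : ‖d₁‖ ≤ r) (h₂ : ‖d₂‖ ≤ r)
    (hd : ‖d₁ - d₂‖ ≤ δ) : ‖B₁ d₁ d₁ - B₂ d₂ d₂‖ ≤ β * r * r + 2 * (L * r * δ) := by
  have hδ : 0 ≤ δ := (norm_nonneg _).trans hd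
  have hβ : 0 ≤ β := (norm_nonneg _).trans hB
  have h : B₁ d₁ d₁ - B₂ d₂ d₂ = (B₁ - B₂) d₁ d₁ + (B₂ (d₁ - d₂) d₁ + B₂ d₂ (d₁ - d₂)) := by
    simp only [map_sub, sub_apply]
    abel
  rw [h]
  have e1 : ‖(B₁ - B₂) d₁ d₁‖ ≤ β * r * r :=
    (ContinuousLinearMap.le_opNorm₂ _ _ _).trans (by gcongr)
  have e2 : ‖B₂ (d₁ - d₂) d₁‖ ≤ L * δ * r :=
    (ContinuousLinearMap.le_opNorm₂ _ _ _).trans (by gcongr)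
  have e3 : ‖B₂ d₂ (d₁ - d₂)‖ ≤ L * r * δ :=
    (ContinuousLinearMap.le_opNorm₂ _ _ _).trans (by gcongr)
  have e4 := norm_add_le ((B₁ - B₂) d₁ d₁) (B₂ (d₁ - d₂) d₁ + B₂ d₂ (d₁ - d₂))
  have e5 := norm_add_le (B₂ (d₁ - d₂) d₁) (B₂ d₂ (d₁ - d₂))
  nlinarith

/-- Two nearby points are joined by a short solution of `c'' = B(c)(c', c')`. -/
theorem exists_boundaryValue_solution {B : E → E →L[ℝ] E →L[ℝ] E} {y₀ : E} {R : ℝ} (hR : 0 < R)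
    {L : NNReal} (hBL : ∀ y ∈ Metric.closedBall y₀ R, ‖B y‖ ≤ L)
    (hBlip : LipschitzOnWith L B (Metric.closedBall y₀ R)) :
    ∃ δ > 0, ∀ x ∈ Metric.ball y₀ δ, ∀ y ∈ Metric.ball y₀ δ, ∃ c c' : ℝ → E,
      c 0 = x ∧ c 1 = y ∧ MapsTo c (Icc 0 1) (Metric.closedBall y₀ R) ∧
      (∀ t ∈ Icc (0 : ℝ) 1, HasDerivWithinAt c (c' t) (Icc 0 1) t) ∧
      (∀ t ∈ Icc (0 : ℝ) 1, HasDerivWithinAt c' (B (c t) (c' t) (c' t)) (Icc 0 1) t) ∧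
      ∀ t ∈ Icc (0 : ℝ) 1, ‖c' t‖ ≤ 3 * ‖y - x‖ := by
  have hL0 : (0 : ℝ) ≤ L := L.2
  -- With `r = ‖y - x‖ ≤ 2δ`, the curve stays within `δ + r + 2r ≤ 7δ ≤ R` of `y₀`. The right-hand
  -- side has norm at most `9Lr² ≤ r`, and its Lipschitz constant in the unknown is at most `18Lr² +
  -- 12Lr ≤ 30Lr ≤ 1/2`.
  obtain ⟨δ, hδ, hδR, hδ1, hδL⟩ : ∃ δ > 0, 7 * δ ≤ R ∧ 2 * δ ≤ 1 ∧ 2 * δ * (60 * (L + 1)) ≤ 1 := by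
    refine ⟨min (R / 7) (1 / (120 * (L + 1))), by positivity, ?_, ?_, ?_⟩
    · linarith [min_le_left (R / 7) (1 / (120 * (L + 1) : ℝ))]
    · have h1 := min_le_right (R / 7) (1 / (120 * (L + 1) : ℝ))
      have h2 : 1 / (120 * (L + 1) : ℝ) ≤ 1 / 120 := by
        apply one_div_le_one_div_of_le <;> linarith
      linarith
    · have h1 := min_le_right (R / 7) (1 / (120 * (L + 1) : ℝ))
      rw [le_div_iff₀ (by positivity)] at h1
      linarith
  refine ⟨δ, hδ, fun x hx y hy => ?_⟩
  rw [Metric.mem_ball, dist_eq_norm] at hx hy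
  set r := ‖y - x‖ with hr_def
  have hr0 : 0 ≤ r := norm_nonneg _
  have hr : r ≤ 2 * δ := by
    have := norm_sub_le (y - y₀) (x - y₀)
    rw [sub_sub_sub_cancel_right] at this
    linarith
  have hr1 : r ≤ 1 := hr.trans hδ1
  have hrL : r * (60 * (L + 1)) ≤ 1 := le_trans (by gcongr) hδL
  -- The unknown is the acceleration `w = c''`. Position and velocity are recovered from it through
  -- the primitives that vanish at both ends, so `c 0 = x` and `c 1 = y` hold for every `w`, and a
  -- solution is a fixed point in the ball of radius `r`.
  let vel : C(Icc (0 : ℝ) 1, E) → ℝ → E := fun w t => (y - x) + centeredPrimitive w t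
  let pos : C(Icc (0 : ℝ) 1, E) → ℝ → E := fun w t => x + t • (y - x) + greenPrimitive w t
  have hvel (w : C(Icc (0 : ℝ) 1, E)) (hw : ‖w‖ ≤ r) (t : ℝ) (ht : t ∈ Icc (0 : ℝ) 1) :
      ‖vel w t‖ ≤ 3 * r := by
    have h1 := norm_centeredPrimitive_le w ht
    have h2 := norm_add_le (y - x) (centeredPrimitive w t)
    simp only [vel]
    linarith
  have hpos (w : C(Icc (0 : ℝ) 1, E)) (hw : ‖w‖ ≤ r) (t : ℝ) (ht : t ∈ Icc (0 : ℝ) 1) :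
      pos w t ∈ Metric.closedBall y₀ R := by
    rw [Metric.mem_closedBall, dist_eq_norm]
    have h1 := norm_greenPrimitive_le w ht
    have h2 : ‖t • (y - x)‖ ≤ r := by
      rw [norm_smul, Real.norm_eq_abs, abs_of_nonneg ht.1]
      exact mul_le_of_le_one_left hr0 ht.2
    have h3 : pos w t - y₀ = (x - y₀) + (t • (y - x) + greenPrimitive w t) := by
      simp only [pos]; abel
    have h4 := norm_add_le (x - y₀) (t • (y - x) + greenPrimitive w t)
    have h5 := norm_add_le (t • (y - x)) (greenPrimitive w t)
    rw [h3]
    linarith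
  have hvelc (w : C(Icc (0 : ℝ) 1, E)) : Continuous (vel w) :=
    continuous_const.add (continuous_centeredPrimitive w)
  have hposc (w : C(Icc (0 : ℝ) 1, E)) : Continuous (pos w) :=
    (by fun_prop : Continuous fun t : ℝ => x + t • (y - x)).add (continuous_greenPrimitive w)
  let K : Set C(Icc (0 : ℝ) 1, E) := Metric.closedBall 0 r
  have hK (w : K) : ‖(w : C(Icc (0 : ℝ) 1, E))‖ ≤ r := by
    exact mem_closedBall_zero_iff.1 w.2
  let Φ : K → C(Icc (0 : ℝ) 1, E) := fun w =>
    ⟨fun t => B (pos w t) (vel w t) (vel w t), by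
      have h1 : Continuous fun t : Icc (0 : ℝ) 1 => B (pos w t) :=
        hBlip.continuousOn.comp_continuous ((hposc w).comp continuous_subtype_val)
          fun t => hpos w (hK w) t t.2
      have h2 : Continuous fun t : Icc (0 : ℝ) 1 => vel w t :=
        (hvelc w).comp continuous_subtype_val
      exact (h1.clm_apply h2).clm_apply h2⟩
  have hΦK (w : K) : Φ w ∈ K := by
    rw [mem_closedBall_zero_iff, ContinuousMap.norm_le _ hr0]
    intro t
    have h1 := hvel w (hK w) t t.2
    calc ‖B (pos w t) (vel w t) (vel w t)‖
        ≤ ‖B (pos w t)‖ * ‖vel w t‖ * ‖vel w t‖ := ContinuousLinearMap.le_opNorm₂ _ _ _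
      _ ≤ L * (3 * r) * (3 * r) := by
          gcongr
          exact hBL _ (hpos w (hK w) t t.2)
      _ ≤ r := by nlinarith [mul_nonneg hr0 hL0]
  have hΦlip : ContractingWith (1 / 2) fun w : K => (⟨Φ w, hΦK w⟩ : K) := by
    refine ⟨by rw [div_lt_one] <;> norm_num, LipschitzWith.of_dist_le_mul fun w₁ w₂ => ?_⟩
    rw [Subtype.dist_eq, Subtype.dist_eq, dist_eq_norm, dist_eq_norm,
      ContinuousMap.norm_le _ (by positivity)]
    intro t
    set η := ‖(w₁ : C(Icc (0 : ℝ) 1, E)) - (w₂ : C(Icc (0 : ℝ) 1, E))‖ with hη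
    have hη0 : 0 ≤ η := norm_nonneg _
    have h1 : ‖vel w₁ t - vel w₂ t‖ ≤ 2 * η := by
      have : vel w₁ t - vel w₂ t = centeredPrimitive ((w₁ : C(Icc (0 : ℝ) 1, E)) - (w₂ : C(Icc (0 : ℝ) 1, E))) t := by
        rw [centeredPrimitive_sub]; simp only [vel]; abel
      rw [this]
      exact norm_centeredPrimitive_le _ t.2
    have h2 : ‖B (pos w₁ t) - B (pos w₂ t)‖ ≤ L * (2 * η) := by
      refine (hBlip.norm_sub_le (hpos w₁ (hK w₁) t t.2) (hpos w₂ (hK w₂) t t.2)).trans ?_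
      have : pos w₁ t - pos w₂ t = greenPrimitive ((w₁ : C(Icc (0 : ℝ) 1, E)) - (w₂ : C(Icc (0 : ℝ) 1, E))) t := by
        rw [greenPrimitive_sub]; simp only [pos]; abel
      rw [this]
      gcongr
      exact norm_greenPrimitive_le _ t.2
    have h3 := norm_bilinear_sub_le hL0 (by positivity : 0 ≤ 3 * r)
      (hBL _ (hpos w₂ (hK w₂) t t.2)) h2 (hvel w₁ (hK w₁) t t.2) (hvel w₂ (hK w₂) t t.2) h1
    refine h3.trans ?_
    have h4 : r * r * (L * η) ≤ r * (L * η) := by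
      have : 0 ≤ r * (L * η) := by positivity
      nlinarith
    have h5 : r * (L * η) * 60 ≤ η := by nlinarith [mul_nonneg hr0 hη0]
    push_cast
    nlinarith
  have hne : Nonempty K := ⟨⟨0, by simp [K, hr0]⟩⟩
  have hcomplete : CompleteSpace K := Metric.isClosed_closedBall.completeSpace_coe
  set w := ContractingWith.fixedPoint _ hΦlip
  have hw : (⟨Φ w, hΦK w⟩ : K) = w := hΦlip.fixedPoint_isFixedPt
  have hw' : Φ w = w := congrArg Subtype.val hw
  refine ⟨pos w, vel w, by simp [pos, greenPrimitive_zero], by simp [pos, greenPrimitive_one],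
    fun t ht => hpos w (hK w) t ht, fun t _ => ?_, fun t ht => ?_, fun t ht => hvel w (hK w) t ht⟩
  · have h1 : HasDerivAt (fun t : ℝ => x + t • (y - x)) (y - x) t := by
      simpa using ((hasDerivAt_id t).smul_const (y - x)).const_add x
    exact (h1.add (hasDerivAt_greenPrimitive w t)).hasDerivWithinAt
  · have h1 : HasDerivAt (vel w) (IccExtend zero_le_one (w : C(Icc (0 : ℝ) 1, E)) t) t :=
      (hasDerivAt_centeredPrimitive (w : C(Icc (0 : ℝ) 1, E)) t).const_add (y - x)
    have h2 : IccExtend zero_le_one (w : C(Icc (0 : ℝ) 1, E)) t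
        = B (pos w t) (vel w t) (vel w t) := by
      rw [IccExtend_of_mem _ _ ht]
      exact (congrArg (fun f : C(Icc (0 : ℝ) 1, E) => f ⟨t, ht⟩) hw').symm
    rw [← h2]
    exact h1.hasDerivWithinAt

/-- A linear equation `V' = A V` on `[0, 1]` with small coefficients is solvable. -/
theorem exists_linear_solution {A : ℝ → E →L[ℝ] E} {a : ℝ} (ha : a ≤ 1 / 2)
    (hA : ContinuousOn A (Icc 0 1)) (hAa : ∀ t ∈ Icc (0 : ℝ) 1, ‖A t‖ ≤ a) (v : E) :
    ∃ V : ℝ → E, V 0 = v ∧ (∀ t ∈ Icc (0 : ℝ) 1, HasDerivWithinAt V (A t (V t)) (Icc 0 1) t) ∧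
      ‖V 1 - v‖ ≤ 2 * a * ‖v‖ := by
  have ha0 : 0 ≤ a := (norm_nonneg _).trans (hAa 0 (by simp))
  let T : C(Icc (0 : ℝ) 1, E) → C(Icc (0 : ℝ) 1, E) := fun V =>
    ⟨fun t => A t (V t), (continuousOn_iff_continuous_domRestrict.1 hA).clm_apply V.continuous⟩
  have hT (V : C(Icc (0 : ℝ) 1, E)) : ‖T V‖ ≤ a * ‖V‖ := by
    rw [ContinuousMap.norm_le _ (by positivity)]
    intro t
    refine ((A t).le_opNorm _).trans ?_
    gcongr
    · exact hAa t t.2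
    · exact V.norm_coe_le_norm t
  have hTsub (V₁ V₂ : C(Icc (0 : ℝ) 1, E)) : T V₁ - T V₂ = T (V₁ - V₂) := by
    ext t
    exact (map_sub (A t) _ _).symm
  -- The Picard operator contracts on the whole space because `a ≤ 1/2`. The same bound absorbs `a *
  -- ‖V‖` in `‖V‖ ≤ ‖v‖ + a * ‖V‖` and gives the factor `2`.
  let Ψ : C(Icc (0 : ℝ) 1, E) → C(Icc (0 : ℝ) 1, E) := fun V =>
    ⟨fun t => v + primitive (T V) t,
      continuous_const.add ((continuous_primitive _).comp continuous_subtype_val)⟩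
  have hΨ : ContractingWith (1 / 2) Ψ := by
    refine ⟨by rw [div_lt_one] <;> norm_num, LipschitzWith.of_dist_le_mul fun V₁ V₂ => ?_⟩
    rw [dist_eq_norm, dist_eq_norm, ContinuousMap.norm_le _ (by positivity)]
    intro t
    have h1 : (Ψ V₁ - Ψ V₂) t = primitive (T (V₁ - V₂)) t := by
      rw [← hTsub, primitive_sub]
      simp [Ψ]
    rw [h1]
    refine (norm_primitive_le _ t.2).trans ((hT _).trans ?_)
    push_cast
    gcongr
  set V := ContractingWith.fixedPoint Ψ hΨ
  have hV : Ψ V = V := hΨ.fixedPoint_isFixedPt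
  have hVt (t : Icc (0 : ℝ) 1) : V t = v + primitive (T V) t := by
    conv_lhs => rw [← hV]
    rfl
  have hVnorm : ‖V‖ ≤ 2 * ‖v‖ := by
    have h1 : ‖V‖ ≤ ‖v‖ + a * ‖V‖ := by
      rw [ContinuousMap.norm_le _ (by positivity)]
      intro t
      rw [hVt]
      exact (norm_add_le _ _).trans (by gcongr; exact (norm_primitive_le _ t.2).trans (hT V))
    nlinarith [norm_nonneg V]
  refine ⟨fun t => v + primitive (T V) t, by simp [primitive], fun t ht => ?_, ?_⟩
  · have h1 := (hasDerivAt_primitive (T V) t).const_add v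
    have h2 : IccExtend zero_le_one (T V) t = A t (v + primitive (T V) t) := by
      rw [IccExtend_of_mem _ _ ht, ← hVt ⟨t, ht⟩]
      rfl
    rw [← h2]
    exact h1.hasDerivWithinAt
  · rw [add_sub_cancel_left]
    refine (norm_primitive_le _ (by simp)).trans ((hT V).trans ?_)
    nlinarith [norm_nonneg V]

end ODE

/-! ### Short geodesics and parallel transport with uniform bounds. -/

section LocalGeodesics

variable {E : Type*} [NormedAddCommGroup E] [NormedSpace ℝ E] [FiniteDimensional ℝ E]
  {M : Type*} [TopologicalSpace M] [ChartedSpace E M] [IsManifold 𝓘(ℝ, E) ∞ M]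
  [RiemannianBundle (fun x : M => TangentSpace 𝓘(ℝ, E) x)]
  [IsContMDiffRiemannianBundle 𝓘(ℝ, E) ∞ E (fun x : M => TangentSpace 𝓘(ℝ, E) x)]

/-- The squared Riemannian norm is `chartMetricL x₀ y v v`, and the operator norm of the metric is
locally bounded by continuity. -/
theorem exists_norm_tangentOfCoord_le (x₀ : M) :
    ∃ C : ℝ, 0 ≤ C ∧ ∀ᶠ y in 𝓝 (extChartAt 𝓘(ℝ, E) x₀ x₀), ∀ v : E,
      ‖(tangentOfCoord x₀ y v).2‖ ≤ C * ‖v‖ := by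
  have hc : ContinuousAt (chartMetricL x₀) (extChartAt 𝓘(ℝ, E) x₀ x₀) :=
    (contDiffOn_chartMetricL x₀).continuousOn.continuousAt
      ((isOpen_extChartAt_target (I := 𝓘(ℝ, E)) x₀).mem_nhds (mem_extChartAt_target x₀))
  set L := ‖chartMetricL x₀ (extChartAt 𝓘(ℝ, E) x₀ x₀)‖ + 1
  have hL : ∀ᶠ y in 𝓝 (extChartAt 𝓘(ℝ, E) x₀ x₀), ‖chartMetricL x₀ y‖ < L :=
    hc.norm.eventually_lt continuousAt_const (by simp [L])
  refine ⟨Real.sqrt L, Real.sqrt_nonneg _, hL.mono fun y hy v => ?_⟩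
  refine le_of_sq_le_sq ?_ (by positivity)
  have h1 : ‖(tangentOfCoord x₀ y v).2‖ ^ 2 = chartMetricL x₀ y v v :=
    (real_inner_self_eq_norm_sq (tangentOfCoord x₀ y v).2).symm
  rw [h1, mul_pow, Real.sq_sqrt ((norm_nonneg _).trans hy.le)]
  calc chartMetricL x₀ y v v ≤ ‖chartMetricL x₀ y v v‖ := Real.le_norm_self _
    _ ≤ ‖chartMetricL x₀ y‖ * ‖v‖ * ‖v‖ := ContinuousLinearMap.le_opNorm₂ _ _ _
    _ ≤ L * ‖v‖ ^ 2 := by rw [mul_assoc, ← sq]; gcongr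

/-- Uniform data on geodesics and parallel transport in the ball of radius `δ` around `x₀` in
the chart at `x₀`. -/
structure IsTransportBall (x₀ : M) (δ C : ℝ) : Prop where
  radius_pos : 0 < δ
  const_nonneg : 0 ≤ C
  subset_target : Metric.ball (extChartAt 𝓘(ℝ, E) x₀ x₀) δ ⊆ (extChartAt 𝓘(ℝ, E) x₀).target
  norm_le : ∀ y ∈ Metric.ball (extChartAt 𝓘(ℝ, E) x₀ x₀) δ, ∀ v : E,
    ‖(tangentOfCoord x₀ y v).2‖ ≤ C * ‖v‖
  exists_transport : ∀ x ∈ Metric.ball (extChartAt 𝓘(ℝ, E) x₀ x₀) δ,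
    ∀ y ∈ Metric.ball (extChartAt 𝓘(ℝ, E) x₀ x₀) δ, ∃ U : ℝ → TangentBundle 𝓘(ℝ, E) M,
      IsGeodesicOn U (Icc 0 1) ∧ (U 0).proj = (extChartAt 𝓘(ℝ, E) x₀).symm x ∧
      (U 1).proj = (extChartAt 𝓘(ℝ, E) x₀).symm y ∧ ‖(U 0).2‖ ≤ C * ‖y - x‖ ∧
      ∀ v : E, ∃ V : ℝ → TangentBundle 𝓘(ℝ, E) M, IsParallelOn V (Icc 0 1) ∧
        (∀ t ∈ Icc (0 : ℝ) 1, (V t).proj = (U t).proj) ∧ V 0 = tangentOfCoord x₀ x v ∧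
        ∃ v' : E, V 1 = tangentOfCoord x₀ y v' ∧ ‖v' - v‖ ≤ C * ‖y - x‖ * ‖v‖

/-- Solving a boundary value problem gives a geodesic between two prescribed points, with initial
velocity controlled by their coordinate distance; no inverse of the exponential map is needed.
Transport along it is a linear equation with coefficients at most `3L‖y - x‖`. -/
theorem exists_isTransportBall (x₀ : M) : ∃ δ C, IsTransportBall (E := E) x₀ δ C := by
  set y₀ := extChartAt 𝓘(ℝ, E) x₀ x₀ with hy₀
  obtain ⟨B, hBd, hB⟩ := exists_transport_operator (E := E) x₀
  have hBop : IsTransportOperator x₀ B := hB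
  have htarget : (extChartAt 𝓘(ℝ, E) x₀).target ∈ 𝓝 y₀ :=
    (isOpen_extChartAt_target (I := 𝓘(ℝ, E)) x₀).mem_nhds (mem_extChartAt_target x₀)
  have hBat : ContDiffAt ℝ 1 B y₀ := hBd.contDiffAt htarget
  obtain ⟨L₁, N, hN, hlip⟩ := hBat.exists_lipschitzOnWith
  have hbound : ∀ᶠ y in 𝓝 y₀, ‖B y‖ < ‖B y₀‖ + 1 :=
    hBat.continuousAt.norm.eventually_lt continuousAt_const (by simp)
  obtain ⟨C₁, hC₁, hnorm⟩ := exists_norm_tangentOfCoord_le (E := E) x₀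
  obtain ⟨R, hR, hRsub⟩ := Metric.nhds_basis_closedBall.mem_iff.1
    (inter_mem (inter_mem htarget hN) (inter_mem hbound hnorm))
  set L : NNReal := L₁ + ⟨‖B y₀‖ + 1, by positivity⟩ with hL
  have hL0 : (0 : ℝ) ≤ L := L.2
  have hBL : ∀ y ∈ Metric.closedBall y₀ R, ‖B y‖ ≤ L := fun y hy => by
    have h1 : ‖B y‖ < ‖B y₀‖ + 1 := (hRsub hy).2.1
    have h2 : (L : ℝ) = L₁ + (‖B y₀‖ + 1) := by rw [hL]; rfl
    have := L₁.2
    rw [h2]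
    exact h1.le.trans (le_add_of_nonneg_left this)
  have hBlip : LipschitzOnWith L B (Metric.closedBall y₀ R) :=
    (hlip.mono fun y hy => (hRsub hy).1.2).weaken le_self_add
  obtain ⟨δ, hδ, hsol⟩ := exists_boundaryValue_solution hR hBL hBlip
  -- The radius `1 / (12 (L + 1))` makes `3L‖y - x‖ ≤ 1/2`, as the linear equation requires. In the
  -- constant, `3C₁` bounds the initial velocity and `6L` the change of coordinates under transport.
  refine ⟨min (min δ R) (1 / (12 * (L + 1))), 3 * C₁ + 6 * L, by positivity, by positivity,
    fun y hy => ?_, fun y hy v => ?_, fun x hx y hy => ?_⟩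
  · exact (hRsub (Metric.ball_subset_closedBall (Metric.ball_subset_ball
      ((min_le_left _ _).trans (min_le_right _ _)) hy))).1.1
  · have h1 : ‖(tangentOfCoord x₀ y v).2‖ ≤ C₁ * ‖v‖ :=
      (hRsub (Metric.ball_subset_closedBall (Metric.ball_subset_ball
        ((min_le_left _ _).trans (min_le_right _ _)) hy))).2.2 v
    refine h1.trans ?_
    gcongr
    linarith
  · have hsub : Metric.ball y₀ (min (min δ R) (1 / (12 * (L + 1)))) ⊆ Metric.ball y₀ δ :=
      Metric.ball_subset_ball ((min_le_left _ _).trans (min_le_left _ _))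
    obtain ⟨c, c', hc0, hc1, hcR, hc, hc', hcn⟩ := hsol x (hsub hx) y (hsub hy)
    have hct : MapsTo c (Icc 0 1) (extChartAt 𝓘(ℝ, E) x₀).target :=
      fun t ht => (hRsub (hcR ht)).1.1
    have hr : ‖y - x‖ * (6 * (L + 1)) ≤ 1 := by
      have h1 := Metric.mem_ball.1 (Metric.ball_subset_ball (min_le_right _ _) hx)
      have h2 := Metric.mem_ball.1 (Metric.ball_subset_ball (min_le_right _ _) hy)
      rw [dist_eq_norm, lt_div_iff₀ (by positivity)] at h1 h2
      have h3 := norm_sub_le (y - y₀) (x - y₀)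
      rw [sub_sub_sub_cancel_right] at h3
      nlinarith
    refine ⟨fun t => tangentOfCoord x₀ (c t) (c' t), hBop.isGeodesicOn hct hc hc',
      by simp only [hc0]; rfl, by simp only [hc1]; rfl, ?_, fun v => ?_⟩
    · have h0 : (0 : ℝ) ∈ Icc (0 : ℝ) 1 := by simp
      have h1 : ‖(tangentOfCoord x₀ (c 0) (c' 0)).2‖ ≤ C₁ * ‖c' 0‖ := (hRsub (hcR h0)).2.2 _
      have h2 := hcn 0 h0
      refine h1.trans ?_
      have h3 : C₁ * ‖c' 0‖ ≤ C₁ * (3 * ‖y - x‖) := by gcongr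
      have h4 : 0 ≤ 6 * (L : ℝ) * ‖y - x‖ := by positivity
      linarith
    · have hAc : ContinuousOn (fun t => B (c t) (c' t)) (Icc 0 1) :=
        (hBlip.continuousOn.comp (fun t ht => (hc t ht).continuousWithinAt) hcR).clm_apply
          fun t ht => (hc' t ht).continuousWithinAt
      have hAa : ∀ t ∈ Icc (0 : ℝ) 1, ‖B (c t) (c' t)‖ ≤ L * (3 * ‖y - x‖) := fun t ht =>
        ((B (c t)).le_opNorm _).trans (by
          gcongr
          · exact hBL _ (hcR ht)
          · exact hcn t ht)
      obtain ⟨V, hV0, hV, hV1⟩ := exists_linear_solution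
        (by nlinarith [norm_nonneg (y - x)]) hAc hAa v
      refine ⟨fun t => tangentOfCoord x₀ (c t) (V t), hBop.isParallelOn hct hc hV,
        fun t _ => rfl, by simp only [hc0, hV0], V 1, by simp only [hc1], ?_⟩
      have h3 : 0 ≤ 3 * C₁ * ‖y - x‖ * ‖v‖ := by positivity
      linarith

/-- Picard–Lindelöf for the first-order system in position and velocity. The speed bound comes from
continuity at time `0` on a shorter interval, which avoids proving that the speed is constant. -/
theorem exists_geodesic (z : TangentBundle 𝓘(ℝ, E) M) :
    ∃ U : ℝ → TangentBundle 𝓘(ℝ, E) M, ∃ ε > 0, ∃ C : ℝ, IsGeodesicOn U (Ioo (-ε) ε) ∧ U 0 = z ∧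
      0 ≤ C ∧ ∀ t ∈ Ioo (-ε) ε, ‖(U t).2‖ ≤ C := by
  set x₀ := z.proj
  set y₀ := extChartAt 𝓘(ℝ, E) x₀ x₀ with hy₀
  obtain ⟨B, hBd, hB⟩ := exists_transport_operator (E := E) x₀
  have hBop : IsTransportOperator x₀ B := hB
  have htarget : (extChartAt 𝓘(ℝ, E) x₀).target ∈ 𝓝 y₀ :=
    (isOpen_extChartAt_target (I := 𝓘(ℝ, E)) x₀).mem_nhds (mem_extChartAt_target x₀)
  have hBat : ContDiffAt ℝ 1 B y₀ := hBd.contDiffAt htarget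
  let f : E × E → E × E := fun q => (q.2, B q.1 q.2 q.2)
  have hf : ContDiffAt ℝ 1 f (y₀, fiberCoord x₀ z) := by
    have h1 : ContDiffAt ℝ 1 (fun q : E × E => B q.1) (y₀, fiberCoord x₀ z) :=
      ContDiffAt.comp (y₀, fiberCoord x₀ z) hBat contDiffAt_fst
    exact contDiffAt_snd.prodMk ((h1.clm_apply contDiffAt_snd).clm_apply contDiffAt_snd)
  obtain ⟨α, hα0, ε, hε, hα⟩ :=
    hf.exists_forall_mem_closedBall_exists_eq_forall_mem_Ioo_hasDerivAt₀ 0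
  rw [zero_sub, zero_add] at hα
  have hcont : ContinuousAt α 0 := (hα 0 (by simp [hε])).continuousAt
  obtain ⟨C, hC, hnorm⟩ := exists_norm_tangentOfCoord_le (E := E) x₀
  have hnear : ∀ᶠ t in 𝓝 (0 : ℝ), (α t).1 ∈ (extChartAt 𝓘(ℝ, E) x₀).target ∩
      {y | ∀ v : E, ‖(tangentOfCoord x₀ y v).2‖ ≤ C * ‖v‖} :=
    hcont.fst.eventually_mem (by rw [hα0]; exact inter_mem htarget hnorm)
  have hnear' : ∀ᶠ t in 𝓝 (0 : ℝ), ‖(α t).2‖ < ‖(α 0).2‖ + 1 :=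
    hcont.snd.norm.eventually_lt continuousAt_const (by simp)
  obtain ⟨η, hη, hηsub⟩ := Metric.mem_nhds_iff.1 (hnear.and hnear')
  have hball : ∀ t ∈ Ioo (-min ε η) (min ε η), t ∈ Metric.ball (0 : ℝ) η := fun t ht => by
    rw [Metric.mem_ball, dist_zero_right, Real.norm_eq_abs, abs_lt]
    exact ⟨(neg_le_neg (min_le_right _ _)).trans_lt ht.1, ht.2.trans_le (min_le_right _ _)⟩
  refine ⟨fun t => tangentOfCoord x₀ (α t).1 (α t).2, min ε η, lt_min hε hη,
    C * (‖(α 0).2‖ + 1), hBop.isGeodesicOn (fun t ht => (hηsub (hball t ht)).1.1)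
      (fun t ht => ?_) (fun t ht => ?_), ?_, by positivity, fun t ht => ?_⟩
  · have h := hα t ⟨(neg_le_neg (min_le_left _ _)).trans_lt ht.1, ht.2.trans_le (min_le_left _ _)⟩
    exact (hasFDerivAt_fst.comp_hasDerivAt t h).hasDerivWithinAt
  · have h := hα t ⟨(neg_le_neg (min_le_left _ _)).trans_lt ht.1, ht.2.trans_le (min_le_left _ _)⟩
    exact (hasFDerivAt_snd.comp_hasDerivAt t h).hasDerivWithinAt
  · simp only [hα0]
    exact tangentOfCoord_fiberCoord (mem_chart_source E x₀)
  · have h := hηsub (hball t ht)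
    refine (h.1.2 _).trans ?_
    gcongr
    exact h.2.le

end LocalGeodesics

/-! ### Bounded linear maps on a decomposition seminorm and their extensions. -/

section Extension

/-- The triangle inequality over each decomposition bounds `‖f A‖` by `C` times its cost.
Boundedness on chains thus needs to be tested only on the elementary differences. -/
theorem norm_map_le_of_costs {P F : Type*} [AddCommGroup P] [Module ℝ P] [NormedAddCommGroup F]
    [NormedSpace ℝ F] {S : P → ℝ → Prop} (hne : ∀ A, (costs S A).Nonempty) (f : P →ₗ[ℝ] F) {C : ℝ}
    (hC : 0 ≤ C) (hf : ∀ A w, S A w → ‖f A‖ ≤ C * w) (A : P) :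
    ‖f A‖ ≤ C * sInf (costs S A) := by
  have key : ∀ s ∈ costs S A, ‖f A‖ ≤ C * s := by
    rintro s ⟨l, hl, rfl, rfl⟩
    clear hne
    induction l with
    | nil => simp
    | cons x l ih =>
      simp only [List.map_cons, List.sum_cons, map_add, mul_add]
      exact (norm_add_le _ _).trans (add_le_add (hf _ _ (hl x (by simp)))
        (ih fun y hy => hl y (List.mem_cons_of_mem _ hy)))
  rcases hC.eq_or_lt with rfl | hC
  · obtain ⟨s, hs⟩ := hne A
    simpa using key s hs
  · rw [← div_le_iff₀' hC]
    exact le_csInf (hne A) fun s hs => (div_le_iff₀' hC).2 (key s hs)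

theorem sInf_costs_le {P : Type*} [AddCommGroup P] {S : P → ℝ → Prop}
    (h0 : ∀ c w, S c w → 0 ≤ w) {A : P} {w : ℝ} (h : S A w) : sInf (costs S A) ≤ w :=
  csInf_le (costs_bddBelow h0 A) ⟨[(A, w)], by simpa using h, by simp, by simp⟩

/-- Identifies the topological extension used to define `boundary` and `pushforward` with a
continuous linear map; without a bound that extension has no useful value. -/
theorem exists_extension {P F : Type*} [SeminormedAddCommGroup P] [NormedSpace ℝ P]
    [NormedAddCommGroup F] [NormedSpace ℝ F] [CompleteSpace F] (f : P →ₗ[ℝ] F) {C : ℝ}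
    (hf : ∀ A, ‖f A‖ ≤ C * ‖A‖) :
    ∃ T : UniformSpace.Completion P →L[ℝ] F, (∀ A : P, T A = f A) ∧
      (UniformSpace.Completion.isDenseInducing_coe (α := P)).extend f = T := by
  let T := (f.mkContinuous C hf).extend (UniformSpace.Completion.toComplL (𝕜 := ℝ) (E := P))
  have hT (A : P) : T A = f A :=
    ContinuousLinearMap.extend_eq _ UniformSpace.Completion.denseRange_coe
      (UniformSpace.Completion.isUniformInducing_coe P) A
  exact ⟨T, hT, IsDenseInducing.extend_unique _ hT T.continuous⟩

end Extension

/-! ### Points and vectors as chains, and the basic inequalities for differences. -/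

section Points

variable {E : Type*} [NormedAddCommGroup E] [NormedSpace ℝ E]
  {M : Type*} [TopologicalSpace M] [ChartedSpace E M] [IsManifold 𝓘(ℝ, E) ∞ M]
  [RiemannianBundle (fun x : M => TangentSpace 𝓘(ℝ, E) x)]

theorem IsZeroDifference.norm_le {A : PointedZeroChain E M} {w : ℝ} (h : IsZeroDifference A w) :
    ‖A‖ ≤ w :=
  sInf_costs_le IsZeroDifference.nonneg h

theorem IsOneDifference.norm_le {A : PointedOneChain E M} {w : ℝ} (h : IsOneDifference A w) :
    ‖A‖ ≤ w :=
  sInf_costs_le IsOneDifference.nonneg h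

theorem norm_map_le_of_isOneDifference {F : Type*} [NormedAddCommGroup F] [NormedSpace ℝ F]
    (f : PointedOneChain E M →ₗ[ℝ] F) {C : ℝ} (hC : 0 ≤ C)
    (hf : ∀ A w, IsOneDifference A w → ‖f A‖ ≤ C * w) (A : PointedOneChain E M) :
    ‖f A‖ ≤ C * ‖A‖ :=
  norm_map_le_of_costs costs_one_nonempty f hC hf A

variable (E) in
/-- The 0-chain `(q; 1)`. -/
def pointChain (q : M) : ZeroChain E M := (zeroElement E q 1 : PointedZeroChain E M)

/-- The 1-chain `(p; v)` for `z = ⟨p, v⟩`. -/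
def vectorChain (z : TangentBundle 𝓘(ℝ, E) M) : OneChain E M :=
  (oneElement z : PointedOneChain E M)

theorem norm_pointChain_le (q : M) : ‖pointChain E q‖ ≤ 1 := by
  rw [pointChain, UniformSpace.Completion.norm_coe]
  simpa using (IsZeroDifference.order_zero (E := E) q 1).norm_le

theorem norm_vectorChain_le (z : TangentBundle 𝓘(ℝ, E) M) : ‖vectorChain z‖ ≤ ‖z.2‖ := by
  rw [vectorChain, UniformSpace.Completion.norm_coe]
  exact (IsOneDifference.order_zero z).norm_le

theorem norm_pointChain_sub_le {U : ℝ → TangentBundle 𝓘(ℝ, E) M}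
    (hU : IsGeodesicOn U (Icc 0 1)) :
    ‖pointChain E (U 1).proj - pointChain E (U 0).proj‖ ≤ ‖(U 0).2‖ := by
  rw [pointChain, pointChain, ← UniformSpace.Completion.coe_sub, UniformSpace.Completion.norm_coe]
  simpa using (IsZeroDifference.order_one U hU 1).norm_le

theorem norm_pointChain_second_difference_le {U W Y Y' : ℝ → TangentBundle 𝓘(ℝ, E) M}
    (hU : IsGeodesicOn U (Icc 0 1)) (hW : IsParallelOn W (Icc 0 1))
    (hY : IsGeodesicOn Y (Icc 0 1)) (hY' : IsGeodesicOn Y' (Icc 0 1))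
    (hUW : ∀ t ∈ Icc (0 : ℝ) 1, (W t).proj = (U t).proj) (hWY : W 0 = Y 0) (hWY' : W 1 = Y' 0) :
    ‖pointChain E (Y' 1).proj - pointChain E (U 1).proj - pointChain E (Y 1).proj
      + pointChain E (U 0).proj‖ ≤ ‖(U 0).2‖ * ‖(Y 0).2‖ := by
  simp only [pointChain]
  rw [← UniformSpace.Completion.coe_sub, ← UniformSpace.Completion.coe_sub,
    ← UniformSpace.Completion.coe_add, UniformSpace.Completion.norm_coe]
  simpa using (IsZeroDifference.order_two U W Y Y' hU hW hY hY' hUW hWY hWY' 1).norm_le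

theorem norm_vectorChain_sub_le {U V : ℝ → TangentBundle 𝓘(ℝ, E) M}
    (hU : IsGeodesicOn U (Icc 0 1)) (hV : IsParallelOn V (Icc 0 1))
    (hUV : ∀ t ∈ Icc (0 : ℝ) 1, (V t).proj = (U t).proj) :
    ‖vectorChain (V 1) - vectorChain (V 0)‖ ≤ ‖(U 0).2‖ * ‖(V 0).2‖ := by
  rw [vectorChain, vectorChain, ← UniformSpace.Completion.coe_sub,
    UniformSpace.Completion.norm_coe]
  exact (IsOneDifference.order_one U V hU hV hUV).norm_le

theorem coe_zeroElement_sub (q q' : M) (a : ℝ) :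
    ((zeroElement E q a - zeroElement E q' a : PointedZeroChain E M) : ZeroChain E M)
      = a • (pointChain E q - pointChain E q') := by
  have h (r : M) : zeroElement E r a = a • zeroElement E r 1 := by
    rw [smul_zeroElement, mul_one]
  rw [h, h, ← smul_sub, UniformSpace.Completion.coe_smul, UniformSpace.Completion.coe_sub]
  rfl

/-- Linearity in the coefficient turns `(U t; 1/t) - (U 0; 1/t)` into a difference quotient of `t ↦
(U t; 1)`. -/
theorem isPrederivative_iff {z : TangentBundle 𝓘(ℝ, E) M} {K : ZeroChain E M} :
    IsPrederivative z K ↔ ∃ U : ℝ → TangentBundle 𝓘(ℝ, E) M, ∃ ε > 0,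
      IsGeodesicOn U (Ioo (-ε) ε) ∧ U 0 = z ∧
      HasDerivAt (fun t => pointChain E (U t).proj) K 0 := by
  refine exists_congr fun U => exists_congr fun ε => and_congr_right fun _ =>
    and_congr_right fun _ => and_congr_right fun h => ?_
  subst h
  rw [hasDerivAt_iff_tendsto_slope_zero]
  simp only [coe_zeroElement_sub, zero_add]

end Points

/-! ### Differentiability from bounded second differences. -/

section SecondDifference

variable {F : Type*} [NormedAddCommGroup F] [NormedSpace ℝ F] [CompleteSpace F]

/-- A curve with bounded second differences satisfies a symmetric difference quotient estimate. -/
theorem norm_smul_sub_smul_le_of_second_difference {f : ℝ → F} {ε C : ℝ}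
    (hcont : ContinuousOn f (Ioo (-ε) ε))
    (h2 : ∀ a b h, a ∈ Ioo (-ε) ε → b ∈ Ioo (-ε) ε → a + h ∈ Ioo (-ε) ε → b + h ∈ Ioo (-ε) ε →
      ‖f (b + h) - f b - f (a + h) + f a‖ ≤ C * |b - a| * |h|)
    {t h : ℝ} (ht : |t| < ε / 2) (hh : |h| < ε / 2) :
    ‖t • (f h - f 0) - h • (f t - f 0)‖ ≤ |C| * |t| * |h| * (|t| + |h|) := by
  rw [abs_lt] at ht hh
  have hε : 0 < ε := by linarith [ht.1, ht.2]
  have hsub (a b : ℝ) (ha : a ∈ Ioo (-ε) ε) (hb : b ∈ Ioo (-ε) ε) :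
      IntervalIntegrable f MeasureTheory.volume a b :=
    (hcont.mono (ordConnected_Ioo.uIcc_subset ha hb)).intervalIntegrable
  have m0 : (0 : ℝ) ∈ Ioo (-ε) ε := ⟨by linarith, hε⟩
  have mt : t ∈ Ioo (-ε) ε := ⟨by linarith [ht.1], by linarith [ht.2]⟩
  have mh : h ∈ Ioo (-ε) ε := ⟨by linarith [hh.1], by linarith [hh.2]⟩
  have mth : t + h ∈ Ioo (-ε) ε := ⟨by linarith [ht.1, hh.1], by linarith [ht.2, hh.2]⟩
  -- Average over `a` between `0` and `t`: the integrand `f (a + h) - f a - (f h - f 0)` is a second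
  -- difference, of norm at most `|C| |t| |h|`.
  have hkey (t h : ℝ) (ht : -(ε / 2) < t ∧ t < ε / 2) (hh : -(ε / 2) < h ∧ h < ε / 2) :
      ‖(∫ a in h..(t + h), f a) - (∫ a in (0 : ℝ)..t, f a) - t • (f h - f 0)‖
        ≤ |C| * |t| * |h| * |t| := by
    have m0 : (0 : ℝ) ∈ Ioo (-ε) ε := ⟨by linarith, hε⟩
    have mt : t ∈ Ioo (-ε) ε := ⟨by linarith [ht.1], by linarith [ht.2]⟩
    have mh : h ∈ Ioo (-ε) ε := ⟨by linarith [hh.1], by linarith [hh.2]⟩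
    have mth : t + h ∈ Ioo (-ε) ε := ⟨by linarith [ht.1, hh.1], by linarith [ht.2, hh.2]⟩
    have e1 : ∫ a in h..(t + h), f a = ∫ a in (0 : ℝ)..t, f (a + h) := by
      rw [intervalIntegral.integral_comp_add_right, zero_add]
    have i1 : IntervalIntegrable (fun a => f (a + h)) MeasureTheory.volume 0 t := by
      have := (hsub (0 + h) (t + h) (by simpa using mh) mth).comp_add_right h
      simpa using this
    have e2 : (∫ a in h..(t + h), f a) - (∫ a in (0 : ℝ)..t, f a) - t • (f h - f 0)
        = ∫ a in (0 : ℝ)..t, (f (a + h) - f a - (f h - f 0)) := by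
      rw [intervalIntegral.integral_sub (i1.sub (hsub 0 t m0 mt)) (by simp),
        intervalIntegral.integral_sub i1 (hsub 0 t m0 mt), e1]
      simp [smul_sub]
    rw [e2]
    have hb : ∀ a ∈ uIoc 0 t, ‖f (a + h) - f a - (f h - f 0)‖ ≤ |C| * |t| * |h| := by
      intro a ha
      have ha' : a ∈ uIcc 0 t := uIoc_subset_uIcc ha
      have ma : a ∈ Ioo (-ε) ε := ordConnected_Ioo.uIcc_subset m0 mt ha'
      have mah : a + h ∈ Ioo (-ε) ε := by
        refine ordConnected_Ioo.uIcc_subset mh mth ?_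
        rw [mem_uIcc] at ha' ⊢
        rcases ha' with ha' | ha'
        · left; constructor <;> linarith [ha'.1, ha'.2]
        · right; constructor <;> linarith [ha'.1, ha'.2]
      have h3 := h2 0 a h m0 ma (by simpa using mh) mah
      rw [zero_add, sub_zero] at h3
      have h4 : f (a + h) - f a - (f h - f 0) = f (a + h) - f a - f h + f 0 := by abel
      rw [h4]
      refine h3.trans ?_
      have h5 : |a| ≤ |t| := by
        have := abs_sub_left_of_mem_uIcc ha'
        simpa using this
      gcongr
      exact le_abs_self C
    have := intervalIntegral.norm_integral_le_of_norm_le_const hb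
    rwa [sub_zero] at this
  have k1 := hkey t h ht hh
  have k2 := hkey h t hh ht
  -- This difference of integrals is symmetric in `t` and `h`, so subtracting the two instances of
  -- `hkey` cancels it.
  have e3 : (∫ a in h..(t + h), f a) - (∫ a in (0 : ℝ)..t, f a)
      = (∫ a in t..(h + t), f a) - (∫ a in (0 : ℝ)..h, f a) := by
    rw [add_comm h t]
    have e4 := intervalIntegral.integral_add_adjacent_intervals (hsub 0 h m0 mh)
      (hsub h (t + h) mh mth)
    have e5 := intervalIntegral.integral_add_adjacent_intervals (hsub 0 t m0 mt)
      (hsub t (t + h) mt mth)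
    rw [sub_eq_sub_iff_add_eq_add, add_comm (∫ a in h..(t + h), f a), e4, ← e5, add_comm]
  rw [e3] at k1
  have e6 : t • (f h - f 0) - h • (f t - f 0)
      = ((∫ a in t..(h + t), f a) - (∫ a in (0 : ℝ)..h, f a) - h • (f t - f 0))
        - ((∫ a in t..(h + t), f a) - (∫ a in (0 : ℝ)..h, f a) - t • (f h - f 0)) := by abel
  rw [e6]
  refine (norm_sub_le _ _).trans ((add_le_add k2 k1).trans (le_of_eq ?_))
  ring

/-- A curve with bounded second differences is differentiable. -/
theorem exists_hasDerivAt_of_second_difference {f : ℝ → F} {ε C : ℝ} (hε : 0 < ε)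
    (hcont : ContinuousOn f (Ioo (-ε) ε))
    (h2 : ∀ a b h, a ∈ Ioo (-ε) ε → b ∈ Ioo (-ε) ε → a + h ∈ Ioo (-ε) ε → b + h ∈ Ioo (-ε) ε →
      ‖f (b + h) - f b - f (a + h) + f a‖ ≤ C * |b - a| * |h|) :
    ∃ K, HasDerivAt f K 0 := by
  simp only [hasDerivAt_iff_tendsto_slope_zero, zero_add]
  refine cauchy_map_iff_exists_tendsto.1 (Metric.cauchy_iff.2 ⟨inferInstance, fun η hη => ?_⟩)
  set ρ := min (ε / 2) (η / (2 * (|C| + 1)))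
  have hρ : 0 < ρ := by positivity
  refine ⟨_, image_mem_map (inter_mem (mem_nhdsWithin_of_mem_nhds (Metric.ball_mem_nhds 0 hρ))
    self_mem_nhdsWithin), ?_⟩
  rintro _ ⟨t, ⟨ht, ht0⟩, rfl⟩ _ ⟨h, ⟨hh, hh0⟩, rfl⟩
  rw [Metric.mem_ball, dist_zero_right, Real.norm_eq_abs] at ht hh
  have ht0' : t ≠ 0 := ht0
  have hh0' : h ≠ 0 := hh0
  have k := norm_smul_sub_smul_le_of_second_difference hcont h2
    (hh.trans_le (min_le_left _ _)) (ht.trans_le (min_le_left _ _))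
  -- Dividing the symmetric estimate by `|t| |h|` bounds the gap between two difference quotients by
  -- `|C| (|t| + |h|)`, so they are Cauchy.
  have e : t⁻¹ • (f t - f 0) - h⁻¹ • (f h - f 0)
      = (t * h)⁻¹ • (h • (f t - f 0) - t • (f h - f 0)) := by
    rw [smul_sub (t * h)⁻¹, smul_smul, smul_smul]
    congr 2 <;> field_simp
  rw [dist_eq_norm, e, norm_smul, norm_inv, Real.norm_eq_abs, abs_mul]
  have hpos : 0 < |t| * |h| := by positivity
  rw [inv_mul_lt_iff₀ hpos]
  refine k.trans_lt ?_
  have h3 : |h| + |t| < 2 * ρ := by linarith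
  have h4 : 2 * ρ * (|C| + 1) ≤ η := by
    have := min_le_right (ε / 2) (η / (2 * (|C| + 1)))
    rw [le_div_iff₀ (by positivity)] at this
    linarith
  have h5 : |C| * (|h| + |t|) < η := by
    have : 0 ≤ |C| := abs_nonneg C
    nlinarith [abs_nonneg h, abs_nonneg t]
  nlinarith

end SecondDifference

/-! ### Existence of the prederivative and its independence of the curve. -/

section Prederivative

variable {E : Type*} [NormedAddCommGroup E] [NormedSpace ℝ E]
  {M : Type*} [TopologicalSpace M] [ChartedSpace E M] [IsManifold 𝓘(ℝ, E) ∞ M]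
  [RiemannianBundle (fun x : M => TangentSpace 𝓘(ℝ, E) x)]

theorem norm_scaleTangent_of_eq {c : ℝ} {z z' : TangentBundle 𝓘(ℝ, E) M} (h : z = z') :
    ‖(scaleTangent c z).2‖ = |c| * ‖z'.2‖ := by
  rw [← h, norm_scaleTangent]

theorem affine_mem_Ioo {ε a b t : ℝ} (ha : a ∈ Ioo (-ε) ε) (hb : b ∈ Ioo (-ε) ε)
    (ht : t ∈ Icc (0 : ℝ) 1) : a + (b - a) * t ∈ Ioo (-ε) ε := by
  have := (convex_Ioo (-ε) ε).add_smul_sub_mem ha hb ht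
  rwa [smul_eq_mul, mul_comm] at this

/-- The part of a geodesic between the times `a` and `b`, as a geodesic on `[0, 1]`. -/
theorem IsGeodesicOn.segment {U : ℝ → TangentBundle 𝓘(ℝ, E) M} {ε a b : ℝ}
    (hU : IsGeodesicOn U (Ioo (-ε) ε)) (ha : a ∈ Ioo (-ε) ε) (hb : b ∈ Ioo (-ε) ε) :
    IsGeodesicOn (fun t => scaleTangent (b - a) (U (a + (b - a) * t))) (Icc 0 1) :=
  hU.comp_affine fun _ ht => affine_mem_Ioo ha hb ht

theorem IsGeodesicOn.norm_pointChain_sub_le {U : ℝ → TangentBundle 𝓘(ℝ, E) M} {ε a b : ℝ}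
    (hU : IsGeodesicOn U (Ioo (-ε) ε)) (ha : a ∈ Ioo (-ε) ε) (hb : b ∈ Ioo (-ε) ε) :
    ‖pointChain E (U b).proj - pointChain E (U a).proj‖ ≤ |b - a| * ‖(U a).2‖ := by
  have h := DifferentialChain.norm_pointChain_sub_le (hU.segment ha hb)
  simp only [scaleTangent_proj, mul_zero, add_zero, mul_one] at h
  rw [add_sub_cancel] at h
  exact h.trans_eq (norm_scaleTangent_of_eq (by simp))

/-- The velocity of a geodesic is parallel along it, so the transport of `h • U a` to time `b` is `h
• U b`. The four points therefore form an element `Δ²` with both displacements along the same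
geodesic. -/
theorem IsGeodesicOn.norm_pointChain_second_difference_le {U : ℝ → TangentBundle 𝓘(ℝ, E) M}
    {ε C : ℝ} (hU : IsGeodesicOn U (Ioo (-ε) ε)) (hC0 : 0 ≤ C)
    (hC : ∀ t ∈ Ioo (-ε) ε, ‖(U t).2‖ ≤ C) {a b h : ℝ} (ha : a ∈ Ioo (-ε) ε)
    (hb : b ∈ Ioo (-ε) ε) (hah : a + h ∈ Ioo (-ε) ε) (hbh : b + h ∈ Ioo (-ε) ε) :
    ‖pointChain E (U (b + h)).proj - pointChain E (U b).proj - pointChain E (U (a + h)).proj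
      + pointChain E (U a).proj‖ ≤ C * C * |b - a| * |h| := by
  have hY := hU.segment ha hah
  have hY' := hU.segment hb hbh
  rw [add_sub_cancel_left] at hY hY'
  have hW : IsParallelOn (fun t => scaleTangent h (U (a + (b - a) * t))) (Icc 0 1) :=
    (hU.1.comp_affine fun _ ht => affine_mem_Ioo ha hb ht).smul h
  have key := DifferentialChain.norm_pointChain_second_difference_le (hU.segment ha hb) hW hY hY'
    (fun _ _ => rfl) (by simp) (by simp)
  simp only [scaleTangent_proj, mul_zero, add_zero, mul_one] at key
  rw [add_sub_cancel] at key
  have e1 : ‖(scaleTangent (b - a) (U (a + (b - a) * 0))).2‖ = |b - a| * ‖(U a).2‖ :=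
    norm_scaleTangent_of_eq (by simp)
  have e2 : ‖(scaleTangent h (U (a + h * 0))).2‖ = |h| * ‖(U a).2‖ :=
    norm_scaleTangent_of_eq (by simp)
  refine key.trans ((congrArg₂ (· * ·) e1 e2).trans_le ?_)
  calc |b - a| * ‖(U a).2‖ * (|h| * ‖(U a).2‖) ≤ |b - a| * C * (|h| * C) := by
        gcongr <;> exact hC a ha
    _ = C * C * |b - a| * |h| := by ring

theorem HasMFDerivAt.hasDerivAt_extChartAt {γ : ℝ → M} {t : ℝ} {v : TangentSpace 𝓘(ℝ, E) (γ t)}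
    (h : HasMFDerivAt 𝓘(ℝ, ℝ) 𝓘(ℝ, E) γ t ((1 : ℝ →L[ℝ] ℝ).smulRight v)) :
    HasDerivAt (fun τ => extChartAt 𝓘(ℝ, E) (γ t) (γ τ)) (v : E) t := by
  have h1 := h.2
  simp only [writtenInExtChartAt, extChartAt_model_space_eq_id, PartialEquiv.refl_symm,
    PartialEquiv.refl_coe, modelWithCornersSelf_coe, range_id, id] at h1
  have h2 : HasFDerivAt (fun τ => extChartAt 𝓘(ℝ, E) (γ t) (γ τ))
      ((1 : ℝ →L[ℝ] ℝ).smulRight (v : E)) t := HasFDerivWithinAt.hasFDerivAt h1 univ_mem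
  exact h2.hasDerivAt.congr_deriv (one_smul ℝ (v : E))

theorem IsGeodesicOn.hasDerivAt_extChartAt {U : ℝ → TangentBundle 𝓘(ℝ, E) M} {ε : ℝ}
    (hε : 0 < ε) (hU : IsGeodesicOn U (Ioo (-ε) ε)) {z : TangentBundle 𝓘(ℝ, E) M} (hz : U 0 = z) :
    HasDerivAt (fun τ => extChartAt 𝓘(ℝ, E) z.proj (U τ).proj) (z.2 : E) 0 ∧
      ContinuousAt (fun τ => (U τ).proj) 0 := by
  subst hz
  have h := (hU.2 0 (by simp [hε])).hasMFDerivAt (Ioo_mem_nhds (by simpa using hε) hε)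
  exact ⟨HasMFDerivAt.hasDerivAt_extChartAt (γ := fun τ => (U τ).proj) h, h.continuousAt⟩

variable [FiniteDimensional ℝ E]
  [IsContMDiffRiemannianBundle 𝓘(ℝ, E) ∞ E (fun x : M => TangentSpace 𝓘(ℝ, E) x)]

/-- The choice in `prederivative` is legitimate: along a geodesic the curve of points has bounded
second differences and so is differentiable at `0`. -/
theorem isPrederivative_prederivative (z : TangentBundle 𝓘(ℝ, E) M) :
    IsPrederivative z (prederivative z) := by
  refine Classical.epsilon_spec (p := IsPrederivative z) ?_
  obtain ⟨U, ε, hε, C, hU, hz, hC0, hC⟩ := exists_geodesic z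
  have hcont : ContinuousOn (fun t => pointChain E (U t).proj) (Ioo (-ε) ε) := by
    refine LipschitzOnWith.continuousOn (K := ⟨C, hC0⟩)
      (LipschitzOnWith.of_dist_le_mul fun b hb a ha => ?_)
    rw [dist_eq_norm, dist_eq_norm, Real.norm_eq_abs]
    refine (hU.norm_pointChain_sub_le ha hb).trans ?_
    rw [mul_comm]
    exact mul_le_mul_of_nonneg_right (hC a ha) (abs_nonneg _)
  obtain ⟨K, hK⟩ := exists_hasDerivAt_of_second_difference hε hcont
    fun a b h ha hb hah hbh => hU.norm_pointChain_second_difference_le hC0 hC ha hb hah hbh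
  exact ⟨K, isPrederivative_iff.2 ⟨U, ε, hε, hU, hz, hK⟩⟩

theorem IsTransportBall.norm_pointChain_sub_le {x₀ : M} {δ C : ℝ}
    (h : IsTransportBall (E := E) x₀ δ C) {x y : E}
    (hx : x ∈ Metric.ball (extChartAt 𝓘(ℝ, E) x₀ x₀) δ)
    (hy : y ∈ Metric.ball (extChartAt 𝓘(ℝ, E) x₀ x₀) δ) :
    ‖pointChain E ((extChartAt 𝓘(ℝ, E) x₀).symm y) - pointChain E ((extChartAt 𝓘(ℝ, E) x₀).symm x)‖
      ≤ C * ‖y - x‖ := by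
  obtain ⟨U, hU, hU0, hU1, hUn, -⟩ := h.exists_transport x hx y hy
  rw [← hU0, ← hU1]
  exact (DifferentialChain.norm_pointChain_sub_le hU).trans hUn

/-- The derivative of `t ↦ (γ t; 1)` is the prederivative of the velocity of `γ`. -/
theorem hasDerivAt_pointChain {γ : ℝ → M} {t : ℝ} {v : TangentSpace 𝓘(ℝ, E) (γ t)}
    (h : HasMFDerivAt 𝓘(ℝ, ℝ) 𝓘(ℝ, E) γ t ((1 : ℝ →L[ℝ] ℝ).smulRight v)) :
    HasDerivAt (fun τ => pointChain E (γ τ)) (prederivative (⟨γ t, v⟩ : TangentBundle 𝓘(ℝ, E) M))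
      t := by
  obtain ⟨U, ε, hε, hU, hz, hK⟩ := isPrederivative_iff.1
    (isPrederivative_prederivative (⟨γ t, v⟩ : TangentBundle 𝓘(ℝ, E) M))
  obtain ⟨hUd, hUc⟩ := hU.hasDerivAt_extChartAt hε hz
  have hγd := HasMFDerivAt.hasDerivAt_extChartAt h
  obtain ⟨δ, C, hball⟩ := exists_isTransportBall (E := E) (γ t)
  set φ := extChartAt 𝓘(ℝ, E) (γ t) with hφ
  have hUp : (U 0).proj = γ t := by rw [hz]
  have hγc : ContinuousAt (fun s : ℝ => γ (t + s)) 0 := by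
    have : ContinuousAt γ (t + 0) := by simpa using h.continuousAt
    exact this.comp (f := fun s : ℝ => t + s) (by fun_prop)
  have hγd' : HasDerivAt (fun s => φ (γ (t + s))) (v : E) 0 := by
    have : HasDerivAt (fun τ => φ (γ τ)) (v : E) (t + 0) := by simpa using hγd
    exact this.comp_const_add t 0
  have hsrc : φ.source ∈ 𝓝 (γ t) := extChartAt_source_mem_nhds (γ t)
  have hb : Metric.ball (φ (γ t)) δ ∈ 𝓝 (φ (γ t)) := Metric.ball_mem_nhds _ hball.radius_pos
  have ev1 : ∀ᶠ s in 𝓝 (0 : ℝ), γ (t + s) ∈ φ.source :=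
    hγc.eventually_mem (by simpa using hsrc)
  have ev2 : ∀ᶠ s in 𝓝 (0 : ℝ), (U s).proj ∈ φ.source :=
    hUc.eventually_mem (by rw [hUp]; exact hsrc)
  have ev3 : ∀ᶠ s in 𝓝 (0 : ℝ), φ (γ (t + s)) ∈ Metric.ball (φ (γ t)) δ :=
    hγd'.continuousAt.eventually_mem (by simpa using hb)
  have ev4 : ∀ᶠ s in 𝓝 (0 : ℝ), φ (U s).proj ∈ Metric.ball (φ (γ t)) δ :=
    hUd.continuousAt.eventually_mem (by rw [hUp]; exact hb)
  -- In the chart, `γ` and the geodesic with the same velocity agree to first order. Points enter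
  -- the 0-chains in a Lipschitz way, so both curves of chains have the same derivative.
  have hdiff : (fun s => φ (γ (t + s)) - φ (U s).proj) =o[𝓝 0] fun s : ℝ => s := by
    have h1 : HasDerivAt (fun s => φ (γ (t + s)) - φ (U s).proj) (0 : E) 0 :=
      (hγd'.sub hUd).congr_deriv (sub_self (v : E))
    simpa [hUp] using hasDerivAt_iff_isLittleO_nhds_zero.1 h1
  have hpt : (fun s => pointChain E (γ (t + s)) - pointChain E (U s).proj) =o[𝓝 0]
      fun s : ℝ => s := by
    refine Asymptotics.IsBigO.trans_isLittleO (Asymptotics.IsBigO.of_bound C ?_) hdiff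
    filter_upwards [ev1, ev2, ev3, ev4] with s h1 h2 h3 h4
    have := hball.norm_pointChain_sub_le h4 h3
    rwa [φ.left_inv h1, φ.left_inv h2] at this
  rw [hasDerivAt_iff_isLittleO_nhds_zero] at hK ⊢
  refine (hpt.add hK).congr_left fun s => ?_
  rw [zero_add, hUp]
  abel

end Prederivative

/-! ### Linearity and boundedness of the boundary. -/

section Boundary

variable {E : Type*} [NormedAddCommGroup E] [NormedSpace ℝ E] [FiniteDimensional ℝ E]
  {M : Type*} [TopologicalSpace M] [ChartedSpace E M] [IsManifold 𝓘(ℝ, E) ∞ M]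
  [RiemannianBundle (fun x : M => TangentSpace 𝓘(ℝ, E) x)]
  [IsContMDiffRiemannianBundle 𝓘(ℝ, E) ∞ E (fun x : M => TangentSpace 𝓘(ℝ, E) x)]

theorem norm_prederivative_le (z : TangentBundle 𝓘(ℝ, E) M) : ‖prederivative z‖ ≤ ‖z.2‖ := by
  obtain ⟨U, ε, hε, hU, hz, hK⟩ := isPrederivative_iff.1 (isPrederivative_prederivative z)
  have h := hK.hasFDerivAt.le_of_lip' (norm_nonneg (U 0).2) ?_
  · rw [ContinuousLinearMap.norm_toSpanSingleton] at h
    subst hz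
    exact h
  · filter_upwards [Ioo_mem_nhds (neg_lt_zero.2 hε) hε] with t ht
    rw [Real.norm_eq_abs, mul_comm]
    exact hU.norm_pointChain_sub_le (by simp [hε]) ht

/-- For small `t`, moving by `t • V 0` and by its transport `t • V 1` gives a second difference of
weight `‖U 0‖ |t| ‖V 0‖`. Dividing by `t` bounds the difference of the derivatives. -/
theorem norm_prederivative_sub_le {U V : ℝ → TangentBundle 𝓘(ℝ, E) M}
    (hU : IsGeodesicOn U (Icc 0 1)) (hV : IsParallelOn V (Icc 0 1))
    (hUV : ∀ t ∈ Icc (0 : ℝ) 1, (V t).proj = (U t).proj) :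
    ‖prederivative (V 1) - prederivative (V 0)‖ ≤ ‖(U 0).2‖ * ‖(V 0).2‖ := by
  obtain ⟨Y, ε, hε, hY, hY0, hK⟩ := isPrederivative_iff.1 (isPrederivative_prederivative (V 0))
  obtain ⟨Y', ε', hε', hY', hY0', hK'⟩ :=
    isPrederivative_iff.1 (isPrederivative_prederivative (V 1))
  have h := (hK'.sub hK).hasFDerivAt.le_of_lip' (C := ‖(U 0).2‖ * ‖(V 0).2‖) (by positivity) ?_
  · rwa [ContinuousLinearMap.norm_toSpanSingleton] at h
  · filter_upwards [Ioo_mem_nhds (neg_lt_zero.2 hε) hε, Ioo_mem_nhds (neg_lt_zero.2 hε') hε']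
      with t ht ht'
    have m0 : (0 : ℝ) ∈ Ioo (-ε) ε := by simp [hε]
    have m0' : (0 : ℝ) ∈ Ioo (-ε') ε' := by simp [hε']
    have q : scaleTangent t (V 0) = scaleTangent (t - 0) (Y (0 + (t - 0) * 0)) := by
      rw [sub_zero, mul_zero, add_zero, hY0]
    have q' : scaleTangent t (V 1) = scaleTangent (t - 0) (Y' (0 + (t - 0) * 0)) := by
      rw [sub_zero, mul_zero, add_zero, hY0']
    have key := norm_pointChain_second_difference_le hU (hV.smul t) (hY.segment m0 ht)
      (hY'.segment m0' ht') hUV q q'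
    have e : ‖(scaleTangent (t - 0) (Y (0 + (t - 0) * 0))).2‖ = |t| * ‖(V 0).2‖ := by
      rw [norm_scaleTangent_of_eq (z' := V 0) (by simp [hY0]), sub_zero]
    have p0 : (Y 0).proj = (U 0).proj := by rw [hY0]; exact hUV 0 (by simp)
    have p0' : (Y' 0).proj = (U 1).proj := by rw [hY0']; exact hUV 1 (by simp)
    have key' := key.trans_eq (congrArg (fun x => ‖(U 0).2‖ * x) e)
    simp only [scaleTangent_proj, sub_zero, zero_add, mul_one] at key'
    rw [Real.norm_eq_abs, sub_zero, Pi.sub_apply, Pi.sub_apply, p0, p0', mul_assoc,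
      mul_comm ‖(V 0).2‖]
    refine Eq.trans_le (congrArg norm ?_) key'
    abel

/-- In a chart, `y ↦ (y; 1)` has directional derivatives. -/
theorem hasDerivAt_pointChain_extChartAt_symm {x₀ : M} {y : E} (v : E) (s : ℝ)
    (hy : y + s • v ∈ (extChartAt 𝓘(ℝ, E) x₀).target) :
    HasDerivAt (fun τ : ℝ => pointChain E ((extChartAt 𝓘(ℝ, E) x₀).symm (y + τ • v)))
      (prederivative (tangentOfCoord x₀ (y + s • v) v)) s := by
  have h1 : HasDerivAt (fun τ : ℝ => y + τ • v) v s := by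
    simpa using ((hasDerivAt_id s).smul_const v).const_add y
  have h2 := HasDerivWithinAt.hasMFDerivWithinAt_extChartAt_symm (x₀ := x₀)
    (h1.hasDerivWithinAt (s := univ)) hy
  exact hasDerivAt_pointChain (h2.hasMFDerivAt univ_mem)

theorem prederivative_tangentOfCoord_smul {x₀ : M} {y : E}
    (hy : y ∈ (extChartAt 𝓘(ℝ, E) x₀).target) (c : ℝ) (v : E) :
    prederivative (tangentOfCoord x₀ y (c • v)) = c • prederivative (tangentOfCoord x₀ y v) := by
  have h1 := hasDerivAt_pointChain_extChartAt_symm (x₀ := x₀) (y := y) (c • v) 0 (by simpa using hy)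
  have h2 := hasDerivAt_pointChain_extChartAt_symm (x₀ := x₀) (y := y) v (c * 0) (by simpa using hy)
  have h3 := h2.scomp (0 : ℝ) ((hasDerivAt_id (0 : ℝ)).const_mul c)
  simp only [mul_zero, zero_smul, add_zero, mul_one] at h1 h3
  refine h1.unique (h3.congr_of_eventuallyEq (Eventually.of_forall fun τ => ?_))
  simp [smul_smul, mul_comm c τ]

namespace IsTransportBall

variable {x₀ : M} {δ C : ℝ}

/-- The lines `y + τ • v` and `y + τ • w` are compared directly, since additivity of the
prederivative is not yet available. -/
theorem norm_prederivative_sub_le_of_vector (h : IsTransportBall (E := E) x₀ δ C) {y : E}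
    (hy : y ∈ Metric.ball (extChartAt 𝓘(ℝ, E) x₀ x₀) δ) (v w : E) :
    ‖prederivative (tangentOfCoord x₀ y v) - prederivative (tangentOfCoord x₀ y w)‖
      ≤ C * ‖v - w‖ := by
  have hyt := h.subset_target hy
  have h1 := hasDerivAt_pointChain_extChartAt_symm (x₀ := x₀) (y := y) v 0 (by simpa using hyt)
  have h2 := hasDerivAt_pointChain_extChartAt_symm (x₀ := x₀) (y := y) w 0 (by simpa using hyt)
  simp only [zero_smul, add_zero] at h1 h2
  have hn (v : E) : ∀ᶠ τ : ℝ in 𝓝 0, y + τ • v ∈ Metric.ball (extChartAt 𝓘(ℝ, E) x₀ x₀) δ := by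
    have hc : ContinuousAt (fun τ : ℝ => y + τ • v) 0 := by fun_prop
    exact hc.eventually_mem (by simpa using Metric.isOpen_ball.mem_nhds hy)
  have k := (h1.sub h2).hasFDerivAt.le_of_lip' (C := C * ‖v - w‖)
    (mul_nonneg h.const_nonneg (norm_nonneg _)) ?_
  · rwa [ContinuousLinearMap.norm_toSpanSingleton] at k
  · filter_upwards [hn v, hn w] with τ hv hw
    have := h.norm_pointChain_sub_le hw hv
    rw [add_sub_add_left_eq_sub, ← smul_sub, norm_smul] at this
    simp only [Pi.sub_apply, zero_smul, add_zero, sub_self, sub_zero]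
    refine this.trans_eq ?_
    ring

/-- Transport `v` from `x` to `y`, then correct its coordinates from `v'` back to `v`; each step
costs `C² ‖v‖ ‖y - x‖`. -/
theorem norm_prederivative_sub_le_of_point (h : IsTransportBall (E := E) x₀ δ C) {x y : E}
    (hx : x ∈ Metric.ball (extChartAt 𝓘(ℝ, E) x₀ x₀) δ)
    (hy : y ∈ Metric.ball (extChartAt 𝓘(ℝ, E) x₀ x₀) δ) (v : E) :
    ‖prederivative (tangentOfCoord x₀ y v) - prederivative (tangentOfCoord x₀ x v)‖
      ≤ 2 * C ^ 2 * ‖v‖ * ‖y - x‖ := by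
  obtain ⟨U, hU, -, -, hUn, hV⟩ := h.exists_transport x hx y hy
  obtain ⟨V, hVp, hUV, hV0, v', hV1, hv'⟩ := hV v
  have h1 := DifferentialChain.norm_prederivative_sub_le hU hVp hUV
  have hV0n : ‖(V 0).2‖ ≤ C * ‖v‖ := by rw [hV0]; exact h.norm_le x hx v
  have h2 := h.norm_prederivative_sub_le_of_vector hy v v'
  rw [norm_sub_rev v v'] at h2
  rw [← hV1] at h2
  rw [← hV0]
  have hC := h.const_nonneg
  calc ‖prederivative (tangentOfCoord x₀ y v) - prederivative (V 0)‖
      ≤ ‖prederivative (tangentOfCoord x₀ y v) - prederivative (V 1)‖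
        + ‖prederivative (V 1) - prederivative (V 0)‖ := norm_sub_le_norm_sub_add_norm_sub _ _ _
    _ ≤ C * (C * ‖y - x‖ * ‖v‖) + (C * ‖y - x‖) * (C * ‖v‖) := by
        refine add_le_add (h2.trans (by gcongr)) (h1.trans (by gcongr))
    _ = 2 * C ^ 2 * ‖v‖ * ‖y - x‖ := by ring

/-- Go from `y` along `τ • v` and then along `τ • w`. On the second leg the derivative in direction
`w` differs from its value `D` at `y` by `O(τ)`, so this leg contributes `τ • D + O(τ²)`. -/
theorem prederivative_tangentOfCoord_add (h : IsTransportBall (E := E) x₀ δ C) {y : E}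
    (hy : y ∈ Metric.ball (extChartAt 𝓘(ℝ, E) x₀ x₀) δ) (v w : E) :
    prederivative (tangentOfCoord x₀ y (v + w))
      = prederivative (tangentOfCoord x₀ y v) + prederivative (tangentOfCoord x₀ y w) := by
  have hyt := h.subset_target hy
  have h1 := hasDerivAt_pointChain_extChartAt_symm (x₀ := x₀) (y := y) (v + w) 0
    (by simpa using hyt)
  have h2 := hasDerivAt_pointChain_extChartAt_symm (x₀ := x₀) (y := y) v 0 (by simpa using hyt)
  simp only [zero_smul, add_zero] at h1 h2
  set D := prederivative (tangentOfCoord x₀ y w)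
  have hC := h.const_nonneg
  have hnear : ∀ᶠ τ : ℝ in 𝓝 0, |τ| * (‖v‖ + ‖w‖) < δ - dist y (extChartAt 𝓘(ℝ, E) x₀ x₀) := by
    have hc : ContinuousAt (fun τ : ℝ => |τ| * (‖v‖ + ‖w‖)) 0 := by fun_prop
    exact hc.eventually_lt continuousAt_const (by simpa using hy)
  set K := 2 * C ^ 2 * ‖w‖ * (‖v‖ + ‖w‖) with hK
  have hest : ∀ᶠ τ : ℝ in 𝓝 0,
      ‖(pointChain E ((extChartAt 𝓘(ℝ, E) x₀).symm (y + τ • (v + w)))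
        - pointChain E ((extChartAt 𝓘(ℝ, E) x₀).symm (y + τ • v))) - τ • D‖ ≤ K * ‖τ ^ 2‖ := by
    filter_upwards [hnear] with τ hτ
    have hdist (s : ℝ) (hs : s ∈ uIcc 0 τ) :
        ‖y + τ • v + s • w - y‖ ≤ |τ| * (‖v‖ + ‖w‖) := by
      have hs' : |s| ≤ |τ| := by simpa using abs_sub_left_of_mem_uIcc hs
      have e : y + τ • v + s • w - y = τ • v + s • w := by abel
      rw [e]
      refine (norm_add_le _ _).trans ?_
      rw [norm_smul, norm_smul, mul_add]
      exact add_le_add le_rfl (mul_le_mul_of_nonneg_right hs' (norm_nonneg _))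
    have hmem (s : ℝ) (hs : s ∈ uIcc 0 τ) :
        y + τ • v + s • w ∈ Metric.ball (extChartAt 𝓘(ℝ, E) x₀ x₀) δ := by
      rw [Metric.mem_ball]
      have h3 := dist_triangle (y + τ • v + s • w) y (extChartAt 𝓘(ℝ, E) x₀ x₀)
      have h4 := hdist s hs
      rw [← dist_eq_norm] at h4
      linarith
    have hd (s : ℝ) (hs : s ∈ uIcc 0 τ) : HasDerivWithinAt
        (fun s : ℝ => pointChain E ((extChartAt 𝓘(ℝ, E) x₀).symm (y + τ • v + s • w)) - s • D)
        (prederivative (tangentOfCoord x₀ (y + τ • v + s • w) w) - D) (uIcc 0 τ) s := by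
      have h3 := hasDerivAt_pointChain_extChartAt_symm (x₀ := x₀) (y := y + τ • v) w s
        (h.subset_target (hmem s hs))
      have h4 : HasDerivAt (fun s : ℝ => s • D) D s := by
        simpa using (hasDerivAt_id s).smul_const D
      exact (h3.sub h4).hasDerivWithinAt
    have key := (convex_uIcc (0 : ℝ) τ).norm_image_sub_le_of_norm_hasDerivWithin_le
      (C := K * |τ|) hd (fun s hs => ?_) left_mem_uIcc right_mem_uIcc
    · simp only [zero_smul, add_zero, sub_zero, Real.norm_eq_abs] at key
      rw [Real.norm_eq_abs, abs_pow, sq, ← mul_assoc, smul_add, ← add_assoc]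
      rw [sub_right_comm]
      exact key
    · refine (h.norm_prederivative_sub_le_of_point hy (hmem s hs) w).trans ?_
      rw [hK, mul_assoc (2 * C ^ 2 * ‖w‖)]
      have := hdist s hs
      rw [mul_comm (‖v‖ + ‖w‖)]
      gcongr
  have h3 : HasDerivAt (fun τ : ℝ => pointChain E ((extChartAt 𝓘(ℝ, E) x₀).symm (y + τ • (v + w)))
        - pointChain E ((extChartAt 𝓘(ℝ, E) x₀).symm (y + τ • v))) D 0 := by
    rw [hasDerivAt_iff_isLittleO_nhds_zero]
    simp only [zero_add, zero_smul, add_zero, sub_self, sub_zero]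
    exact (Asymptotics.IsBigO.of_bound K hest).trans_isLittleO
      (Asymptotics.isLittleO_pow_id one_lt_two)
  have h4 := (h1.sub h2).unique h3
  rw [← h4]
  abel

end IsTransportBall

theorem fiberCoord_add (p : M) (v w : TangentSpace 𝓘(ℝ, E) p) :
    fiberCoord p (⟨p, v + w⟩ : TangentBundle 𝓘(ℝ, E) M)
      = fiberCoord p ⟨p, v⟩ + fiberCoord p ⟨p, w⟩ := by
  simp only [fiberCoord, TangentBundle.trivializationAt_apply]
  exact ContinuousLinearMap.map_add _ _ _

/-- The prederivative at `p` as a linear map. -/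
def prederivativeLinear (p : M) : TangentSpace 𝓘(ℝ, E) p →ₗ[ℝ] ZeroChain E M where
  toFun v := prederivative ⟨p, v⟩
  map_add' v w := by
    obtain ⟨δ, C, h⟩ := exists_isTransportBall (E := E) p
    have e (z : TangentBundle 𝓘(ℝ, E) M) (hz : z.proj = p) :
        tangentOfCoord p (extChartAt 𝓘(ℝ, E) p p) (fiberCoord p z) = z := by
      subst hz
      exact tangentOfCoord_fiberCoord (mem_chart_source E z.proj)
    have k := h.prederivative_tangentOfCoord_add (Metric.mem_ball_self h.radius_pos)
      (fiberCoord p ⟨p, v⟩) (fiberCoord p ⟨p, w⟩)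
    rwa [← fiberCoord_add, e ⟨p, v + w⟩ rfl, e ⟨p, v⟩ rfl, e ⟨p, w⟩ rfl] at k
  map_smul' c v := by
    have e (z : TangentBundle 𝓘(ℝ, E) M) (hz : z.proj = p) :
        tangentOfCoord p (extChartAt 𝓘(ℝ, E) p p) (fiberCoord p z) = z := by
      subst hz
      exact tangentOfCoord_fiberCoord (mem_chart_source E z.proj)
    have k := prederivative_tangentOfCoord_smul (mem_extChartAt_target (I := 𝓘(ℝ, E)) p) c
      (fiberCoord p ⟨p, v⟩)
    have k2 := fiberCoord_smul p c (⟨p, v⟩ : TangentBundle 𝓘(ℝ, E) M)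
    rwa [← k2, e ⟨p, c • v⟩ rfl, e ⟨p, v⟩ rfl] at k

-- The weights of the two kinds of 1-differences are exactly the bounds already found for
-- prederivatives, so the norm of the boundary is at most `1`.
open Classical in
theorem exists_boundary_extension :
    ∃ T : OneChain E M →L[ℝ] ZeroChain E M, boundary = T ∧
      ∀ z : TangentBundle 𝓘(ℝ, E) M, T (vectorChain z) = prederivative z := by
  let f : PointedOneChain E M →ₗ[ℝ] ZeroChain E M :=
    DFinsupp.lsum (M := fun x : M => TangentSpace 𝓘(ℝ, E) x) ℝ prederivativeLinear
  have hf : (f : PointedOneChain E M → ZeroChain E M) = pointedBoundary := by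
    funext A
    exact DFinsupp.sumAddHom_apply _ A
  have hz (z : TangentBundle 𝓘(ℝ, E) M) : f (oneElement z) = prederivative z :=
    DFinsupp.lsum_single (M := fun x : M => TangentSpace 𝓘(ℝ, E) x) ℝ prederivativeLinear
      z.proj z.2
  have hbound : ∀ A, ‖f A‖ ≤ 1 * ‖A‖ := by
    refine norm_map_le_of_isOneDifference f zero_le_one fun A w hA => ?_
    rw [one_mul]
    cases hA with
    | order_zero z =>
      rw [hz]
      exact norm_prederivative_le z
    | order_one U V hU hV hUV =>
      rw [map_sub, hz, hz]
      exact norm_prederivative_sub_le hU hV hUV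
  obtain ⟨T, hT, hext⟩ := exists_extension f hbound
  refine ⟨T, ?_, fun z => (hT _).trans (hz z)⟩
  rw [boundary, ← hf]
  exact hext

end Boundary

/-! ### A Lipschitz vector field as a continuous family of 1-chains. -/

section Orbit

variable {E : Type*} [NormedAddCommGroup E] [NormedSpace ℝ E]
  {M : Type*} [TopologicalSpace M] [ChartedSpace E M] [IsManifold 𝓘(ℝ, E) ∞ M]

theorem HasMFDerivAt.hasDerivAt_extChartAt_of_mem {x₀ : M} {γ : ℝ → M} {t : ℝ}
    {v : TangentSpace 𝓘(ℝ, E) (γ t)}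
    (h : HasMFDerivAt 𝓘(ℝ, ℝ) 𝓘(ℝ, E) γ t ((1 : ℝ →L[ℝ] ℝ).smulRight v))
    (hx : γ t ∈ (chartAt E x₀).source) :
    HasDerivAt (fun τ => extChartAt 𝓘(ℝ, E) x₀ (γ τ))
      (fiberCoord x₀ (⟨γ t, v⟩ : TangentBundle 𝓘(ℝ, E) M)) t := by
  have h1 := (mdifferentiableAt_extChartAt (I := 𝓘(ℝ, E)) hx).hasMFDerivAt.comp t h
  let L : ℝ →L[ℝ] E := (mfderiv 𝓘(ℝ, E) 𝓘(ℝ, E) (extChartAt 𝓘(ℝ, E) x₀) (γ t)).comp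
    ((1 : ℝ →L[ℝ] ℝ).smulRight v)
  have h2 : HasFDerivAt (fun τ => extChartAt 𝓘(ℝ, E) x₀ (γ τ)) L t := h1.hasFDerivAt
  refine h2.hasDerivAt.congr_deriv ?_
  have h3 := TangentBundle.continuousLinearMapAt_trivializationAt (I := 𝓘(ℝ, E)) hx
  have h4 : (trivializationAt E (TangentSpace 𝓘(ℝ, E)) x₀).continuousLinearMapAt ℝ (γ t) v
      = fiberCoord x₀ (⟨γ t, v⟩ : TangentBundle 𝓘(ℝ, E) M) := by
    rw [Trivialization.continuousLinearMapAt_apply, Trivialization.coe_linearMapAt_of_mem]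
    · rfl
    · exact hx
  rw [← h4, h3]
  exact congrArg (mfderiv 𝓘(ℝ, E) 𝓘(ℝ, E) (extChartAt 𝓘(ℝ, E) x₀) (γ t))
    (one_smul ℝ v)

variable [RiemannianBundle (fun x : M => TangentSpace 𝓘(ℝ, E) x)]

theorem vectorChain_tangentOfCoord_sub (x₀ : M) (y v w : E) :
    vectorChain (tangentOfCoord x₀ y v) - vectorChain (tangentOfCoord x₀ y w)
      = vectorChain (tangentOfCoord x₀ y (v - w)) := by
  simp only [vectorChain]
  rw [← UniformSpace.Completion.coe_sub]
  congr 1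
  have h := map_sub ((oneElementLinear E ((extChartAt 𝓘(ℝ, E) x₀).symm y)).comp
    ((trivializationAt E (TangentSpace 𝓘(ℝ, E)) x₀).symmL ℝ
      ((extChartAt 𝓘(ℝ, E) x₀).symm y)).toLinearMap) v w
  exact h.symm

/-- A function which is locally Lipschitz at every point, with a fixed constant, is Lipschitz. -/
theorem norm_sub_le_of_forall_eventually {F : Type*} [NormedAddCommGroup F] {f : ℝ → F} {Λ : ℝ}
    (h : ∀ t, ∀ᶠ s in 𝓝 t, ‖f s - f t‖ ≤ Λ * |s - t|) {a b : ℝ} (hab : a ≤ b) :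
    ‖f b - f a‖ ≤ Λ * (b - a) := by
  have hf : Continuous f := by
    refine continuous_iff_continuousAt.2 fun t => ?_
    rw [ContinuousAt, tendsto_iff_norm_sub_tendsto_zero]
    refine squeeze_zero' (Eventually.of_forall fun _ => norm_nonneg _) (h t) ?_
    have : Continuous fun s : ℝ => Λ * |s - t| := by fun_prop
    simpa using this.tendsto t
  -- Continuous induction: the bound holds on a closed set, which the local estimate extends to the
  -- right of each of its points.
  have hcl : IsClosed ({s | ‖f s - f a‖ ≤ Λ * (s - a)} ∩ Icc a b) :=
    (isClosed_le (by fun_prop) (by fun_prop)).inter isClosed_Icc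
  have key := hcl.Icc_subset_of_forall_mem_nhdsWithin (by simp) fun x hx => by
    filter_upwards [mem_nhdsWithin_of_mem_nhds (h x), self_mem_nhdsWithin] with s hs hxs
    have h1 : ‖f x - f a‖ ≤ Λ * (x - a) := hx.1
    have h2 : ‖f s - f x‖ ≤ Λ * |s - x| := hs
    rw [abs_of_pos (sub_pos.2 hxs)] at h2
    have h3 := norm_sub_le_norm_sub_add_norm_sub (f s) (f x) (f a)
    show ‖f s - f a‖ ≤ Λ * (s - a)
    linarith
  exact key ⟨hab, le_rfl⟩

variable [FiniteDimensional ℝ E]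
  [IsContMDiffRiemannianBundle 𝓘(ℝ, E) ∞ E (fun x : M => TangentSpace 𝓘(ℝ, E) x)]

/-- Local bounds for a Lipschitz vector field and the associated 1-elements. -/
theorem IsLipschitzVectorField.exists_local_bound {X : ∀ x : M, TangentSpace 𝓘(ℝ, E) x}
    (hX : IsLipschitzVectorField X) (x₀ : M) :
    ∃ m Λ : ℝ, 0 ≤ m ∧ 0 ≤ Λ ∧ ∃ W ∈ 𝓝 x₀, W ⊆ (chartAt E x₀).source ∧
      (∀ q ∈ W, ‖X q‖ ≤ m) ∧ (∀ q ∈ W, ‖fiberCoord x₀ ⟨q, X q⟩‖ ≤ m) ∧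
      ∀ q ∈ W, ∀ q' ∈ W, ‖vectorChain ⟨q', X q'⟩ - vectorChain ⟨q, X q⟩‖
        ≤ Λ * ‖extChartAt 𝓘(ℝ, E) x₀ q' - extChartAt 𝓘(ℝ, E) x₀ q‖ := by
  obtain ⟨K, N, hN, hK⟩ := hX x₀
  obtain ⟨δ, C, hball⟩ := exists_isTransportBall (E := E) x₀
  set φ := extChartAt 𝓘(ℝ, E) x₀ with hφ
  have hC := hball.const_nonneg
  set N' := N ∩ Metric.ball (φ x₀) δ with hN'
  have hN'm : N' ∈ 𝓝 (φ x₀) := inter_mem hN (Metric.ball_mem_nhds _ hball.radius_pos)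
  set ξ : E → E := fun y => fiberCoord x₀ ⟨φ.symm y, X (φ.symm y)⟩ with hξ
  set m := ‖ξ (φ x₀)‖ + K * δ with hm
  have hm0 : 0 ≤ m := by have := hball.radius_pos; positivity
  have hξm : ∀ y ∈ N', ‖ξ y‖ ≤ m := fun y hy => by
    have h1 := hK.norm_sub_le hy.1 (mem_of_mem_nhds hN)
    have h2 : ‖y - φ x₀‖ ≤ δ := by rw [← dist_eq_norm]; exact (Metric.mem_ball.1 hy.2).le
    have h3 := norm_sub_norm_le (ξ y) (ξ (φ x₀))
    have h4 : (K : ℝ) * ‖y - φ x₀‖ ≤ K * δ := by gcongr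
    have h5 : ‖ξ y - ξ (φ x₀)‖ ≤ K * ‖y - φ x₀‖ := h1
    linarith
  have hz : ∀ y ∈ N', tangentOfCoord x₀ y (ξ y) = ⟨φ.symm y, X (φ.symm y)⟩ := fun y hy => by
    have ht := hball.subset_target hy.2
    have h1 := tangentOfCoord_fiberCoord (x₀ := x₀)
      (z := (⟨φ.symm y, X (φ.symm y)⟩ : TangentBundle 𝓘(ℝ, E) M))
      (extChartAt_symm_mem_chart_source ht)
    have h2 : extChartAt 𝓘(ℝ, E) x₀ (φ.symm y) = y := φ.right_inv ht
    simp only [h2] at h1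
    exact h1
  -- Pass through the transport `V 1` of the vector at `x`. The term `C (K + C m)` pays for the
  -- change of coordinates at `y`, both from the field and from transport; the term `C (C m)` is the
  -- weight of the transported difference.
  have hlip : ∀ x ∈ N', ∀ y ∈ N', ‖vectorChain (tangentOfCoord x₀ y (ξ y))
      - vectorChain (tangentOfCoord x₀ x (ξ x))‖ ≤ (C * (K + C * m) + C * (C * m)) * ‖y - x‖ := by
    intro x hx y hy
    obtain ⟨U, hU, -, -, hUn, hV⟩ := hball.exists_transport x hx.2 y hy.2
    obtain ⟨V, hVp, hUV, hV0, v', hV1, hv'⟩ := hV (ξ x)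
    have h1 := norm_vectorChain_sub_le hU hVp hUV
    have h2 : ‖(V 0).2‖ ≤ C * m := by
      rw [hV0]
      exact (hball.norm_le x hx.2 _).trans (by gcongr; exact hξm x hx)
    have h3 : ‖vectorChain (tangentOfCoord x₀ y (ξ y)) - vectorChain (V 1)‖
        ≤ C * ((K + C * m) * ‖y - x‖) := by
      rw [hV1, vectorChain_tangentOfCoord_sub]
      refine (norm_vectorChain_le _).trans ((hball.norm_le y hy.2 _).trans ?_)
      have h4 : ‖ξ y - ξ x‖ ≤ K * ‖y - x‖ := hK.norm_sub_le hy.1 hx.1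
      have h5 : ‖v' - ξ x‖ ≤ C * ‖y - x‖ * m := hv'.trans (by gcongr; exact hξm x hx)
      have h6 : ‖ξ y - v'‖ ≤ ‖ξ y - ξ x‖ + ‖v' - ξ x‖ := by
        rw [norm_sub_rev v']
        exact norm_sub_le_norm_sub_add_norm_sub _ _ _
      gcongr
      linarith
    rw [← hV0]
    calc ‖vectorChain (tangentOfCoord x₀ y (ξ y)) - vectorChain (V 0)‖
        ≤ ‖vectorChain (tangentOfCoord x₀ y (ξ y)) - vectorChain (V 1)‖
          + ‖vectorChain (V 1) - vectorChain (V 0)‖ := norm_sub_le_norm_sub_add_norm_sub _ _ _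
      _ ≤ C * ((K + C * m) * ‖y - x‖) + (C * ‖y - x‖) * (C * m) :=
          add_le_add h3 (h1.trans (by gcongr))
      _ = (C * (K + C * m) + C * (C * m)) * ‖y - x‖ := by ring
  refine ⟨m + C * m, C * (K + C * m) + C * (C * m), by positivity, by positivity,
    (chartAt E x₀).source ∩ φ ⁻¹' N', inter_mem (chart_source_mem_nhds E x₀)
      ((continuousAt_extChartAt x₀).preimage_mem_nhds hN'm), inter_subset_left, ?_, ?_, ?_⟩
  · rintro q ⟨hq, hqN⟩
    have hl : φ.symm (φ q) = q := φ.left_inv (by rw [hφ, extChartAt_source]; exact hq)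
    have h1 := hball.norm_le (φ q) hqN.2 (ξ (φ q))
    rw [hz _ hqN] at h1
    have h2 : ‖X (φ.symm (φ q))‖ ≤ C * ‖ξ (φ q)‖ := h1
    rw [hl] at h2
    have h3 : C * ‖ξ (φ q)‖ ≤ C * m := by gcongr; exact hξm _ hqN
    linarith
  · rintro q ⟨hq, hqN⟩
    have hl : φ.symm (φ q) = q := φ.left_inv (by rw [hφ, extChartAt_source]; exact hq)
    have key : ∀ q', φ.symm (φ q) = q' → ‖fiberCoord x₀ ⟨q', X q'⟩‖ ≤ m := by
      rintro _ rfl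
      exact hξm _ hqN
    have h1 := key q hl
    have : 0 ≤ C * m := by positivity
    linarith
  · rintro q ⟨hq, hqN⟩ q' ⟨hq', hqN'⟩
    have hl : φ.symm (φ q) = q := φ.left_inv (by rw [hφ, extChartAt_source]; exact hq)
    have hl' : φ.symm (φ q') = q' := φ.left_inv (by rw [hφ, extChartAt_source]; exact hq')
    have h1 := hlip _ hqN _ hqN'
    rwa [hz _ hqN, hz _ hqN', hl, hl'] at h1

theorem IsLipschitzVectorField.continuous_vectorChain {X : ∀ x : M, TangentSpace 𝓘(ℝ, E) x}
    (hX : IsLipschitzVectorField X) : Continuous fun q => vectorChain ⟨q, X q⟩ := by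
  refine continuous_iff_continuousAt.2 fun x₀ => ?_
  obtain ⟨m, Λ, -, -, W, hW, -, -, -, hlip⟩ := hX.exists_local_bound x₀
  rw [ContinuousAt, tendsto_iff_norm_sub_tendsto_zero]
  refine squeeze_zero' (Eventually.of_forall fun _ => norm_nonneg _)
    (mem_of_superset hW fun q hq => hlip x₀ (mem_of_mem_nhds hW) q hq) ?_
  have h : ContinuousAt (fun q => Λ * ‖extChartAt 𝓘(ℝ, E) x₀ q - extChartAt 𝓘(ℝ, E) x₀ x₀‖) x₀ :=
    continuousAt_const.mul ((continuousAt_extChartAt x₀).sub continuousAt_const).norm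
  simpa using h.tendsto

/-- A finite subcover gives one constant for all local estimates. In a chart the orbit has speed at
most `m x`, and the differentiability error adds `1`, whence the factor `m x + 1`. A local Lipschitz
estimate with a uniform constant is then global in time. -/
theorem IsLipschitzVectorField.exists_orbit_bound [CompactSpace M]
    {X : ∀ x : M, TangentSpace 𝓘(ℝ, E) x} (hX : IsLipschitzVectorField X) {φ : ℝ → M}
    (hφ : IsMIntegralCurve φ X) :
    ∃ Λ : ℝ, 0 ≤ Λ ∧ (∀ t, ‖X (φ t)‖ ≤ Λ) ∧
      ∀ s t, ‖vectorChain ⟨φ s, X (φ s)⟩ - vectorChain ⟨φ t, X (φ t)⟩‖ ≤ Λ * |s - t| := by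
  choose m Λ hm hΛ W hW hWs hXm hξm hlip using hX.exists_local_bound
  obtain ⟨S, hS⟩ := CompactSpace.elim_nhds_subcover (fun x => interior (W x))
    fun x => interior_mem_nhds.2 (hW x)
  set Λ' := ∑ x ∈ S, (m x + Λ x * (m x + 1)) with hΛ'
  have hterm (x : M) : 0 ≤ m x + Λ x * (m x + 1) := by
    have := hm x; have := hΛ x; positivity
  have hle (x : M) (hx : x ∈ S) : m x + Λ x * (m x + 1) ≤ Λ' :=
    Finset.single_le_sum (fun x _ => hterm x) hx
  have hmem (q : M) : ∃ x ∈ S, W x ∈ 𝓝 q := by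
    have : q ∈ ⋃ x ∈ S, interior (W x) := by rw [hS]; trivial
    simp only [mem_iUnion] at this
    obtain ⟨x, hx, hq⟩ := this
    exact ⟨x, hx, mem_interior_iff_mem_nhds.1 hq⟩
  have hloc (t : ℝ) : ∀ᶠ s in 𝓝 t,
      ‖vectorChain ⟨φ s, X (φ s)⟩ - vectorChain ⟨φ t, X (φ t)⟩‖ ≤ Λ' * |s - t| := by
    obtain ⟨x, hx, hq⟩ := hmem (φ t)
    have hqW := mem_of_mem_nhds hq
    have hd := HasMFDerivAt.hasDerivAt_extChartAt_of_mem (hφ t) (hWs x hqW)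
    have hbig := (hasDerivAt_iff_isLittleO.1 hd).def zero_lt_one
    filter_upwards [(hφ t).continuousAt.preimage_mem_nhds hq, hbig] with s hs hs'
    refine (hlip x _ hqW _ hs).trans ?_
    rw [one_mul] at hs'
    have h1 := norm_sub_norm_le (extChartAt 𝓘(ℝ, E) x (φ s) - extChartAt 𝓘(ℝ, E) x (φ t))
      ((s - t) • fiberCoord x (⟨φ t, X (φ t)⟩ : TangentBundle 𝓘(ℝ, E) M))
    rw [norm_smul, Real.norm_eq_abs] at h1
    rw [Real.norm_eq_abs] at hs'
    have h2 : |s - t| * ‖fiberCoord x (⟨φ t, X (φ t)⟩ : TangentBundle 𝓘(ℝ, E) M)‖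
        ≤ |s - t| * m x := by gcongr; exact hξm x _ hqW
    have h3 : ‖extChartAt 𝓘(ℝ, E) x (φ s) - extChartAt 𝓘(ℝ, E) x (φ t)‖
        ≤ (m x + 1) * |s - t| := by linarith
    calc _ ≤ Λ x * ((m x + 1) * |s - t|) := mul_le_mul_of_nonneg_left h3 (hΛ x)
      _ = (Λ x * (m x + 1)) * |s - t| := by ring
      _ ≤ Λ' * |s - t| := by
        gcongr
        linarith [hle x hx, hm x]
  refine ⟨Λ', Finset.sum_nonneg fun x _ => hterm x, fun t => ?_, fun s t => ?_⟩
  · obtain ⟨x, hx, hq⟩ := hmem (φ t)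
    have h1 := hXm x _ (mem_of_mem_nhds hq)
    have h2 : 0 ≤ Λ x * (m x + 1) := by have := hm x; have := hΛ x; positivity
    linarith [hle x hx]
  · rcases le_total t s with h | h
    · rw [abs_of_nonneg (sub_nonneg.2 h)]
      exact norm_sub_le_of_forall_eventually hloc h
    · rw [norm_sub_rev, abs_sub_comm, abs_of_nonneg (sub_nonneg.2 h)]
      exact norm_sub_le_of_forall_eventually hloc h

end Orbit

/-! ### Geodesics, parallel fields and unit elements on the real line. -/

section RealLine

/-- A tangent vector of the real line as a real number. -/
def realTangent (z : TangentBundle 𝓘(ℝ, ℝ) ℝ) : ℝ := z.2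

theorem mem_extChartAt_target_real (x₀ y : ℝ) : y ∈ (extChartAt 𝓘(ℝ, ℝ) x₀).target := by
  rw [extChartAt_model_space_eq_id]
  trivial

theorem fiberCoord_real (x₀ : ℝ) (z : TangentBundle 𝓘(ℝ, ℝ) ℝ) :
    fiberCoord x₀ z = realTangent z := by
  rw [fiberCoord, trivializationAt_model_space_apply]
  rfl

theorem chartMetric_real (x₀ y v w : ℝ) : chartMetric x₀ y v w = chartMetric (0 : ℝ) 0 v w := by
  simp only [chartMetric, TangentBundle.symmL_model_space]
  rfl

theorem christoffel_real (x₀ y u v w : ℝ) : christoffel x₀ y u v w = 0 := by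
  have h (v w : ℝ) : (fun z => chartMetric x₀ z v w) = fun _ => chartMetric (0 : ℝ) 0 v w :=
    funext fun z => chartMetric_real x₀ z v w
  simp [christoffel, h]

theorem isTransportOperator_zero_real (x₀ : ℝ) :
    IsTransportOperator x₀ (0 : ℝ → ℝ →L[ℝ] ℝ →L[ℝ] ℝ) := by
  intro y _ a v w
  rw [christoffel_real, add_zero]
  have := chartMetric_smul_left x₀ y 0 (0 : ℝ) w
  simpa using this

theorem tangentOfCoord_real (x₀ y v : ℝ) :
    tangentOfCoord x₀ y v = (⟨y, v⟩ : TangentBundle 𝓘(ℝ, ℝ) ℝ) := by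
  have h := tangentOfCoord_fiberCoord (x₀ := x₀) (z := (⟨y, v⟩ : TangentBundle 𝓘(ℝ, ℝ) ℝ))
    (by rw [chartAt_self_eq]; trivial)
  rw [fiberCoord_real, extChartAt_model_space_eq_id] at h
  exact h

theorem norm_tangent_real (z : TangentBundle 𝓘(ℝ, ℝ) ℝ) : ‖z.2‖ = |realTangent z| :=
  norm_tangentSpace_vectorSpace

/-- The metric is constant, so the Christoffel symbols vanish and nondegeneracy forces the
derivative to be `0`. Since differences on the line are defined through arbitrary parallel fields
and geodesics, these must be identified before a pushforward can be estimated. -/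
theorem IsParallelOn.realTangent_eq {V : ℝ → TangentBundle 𝓘(ℝ, ℝ) ℝ}
    (hV : IsParallelOn V (Icc 0 1)) {t : ℝ} (ht : t ∈ Icc (0 : ℝ) 1) :
    realTangent (V t) = realTangent (V 0) := by
  have hd : ∀ t ∈ Icc (0 : ℝ) 1,
      HasDerivWithinAt (fun τ => realTangent (V τ)) ((fun _ => 0) t) (Icc 0 1) t := by
    intro t ht
    obtain ⟨x₀, -, a, b, -, hb, hw⟩ := hV.2 t ht
    have h0 : b = 0 := by
      have h1 := hw b
      rw [christoffel_real, add_zero] at h1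
      exact chartMetric_self_eq_zero (mem_extChartAt_target_real _ _) h1
    rw [h0] at hb
    simpa only [fiberCoord_real] using hb
  have h := (convex_Icc (0 : ℝ) 1).norm_image_sub_le_of_norm_hasDerivWithin_le (C := 0) hd
    (by simp) (left_mem_Icc.2 zero_le_one) ht
  rw [zero_mul, norm_le_zero_iff] at h
  exact sub_eq_zero.1 h

theorem IsGeodesicOn.proj_sub_eq_real {U : ℝ → TangentBundle 𝓘(ℝ, ℝ) ℝ}
    (hU : IsGeodesicOn U (Icc 0 1)) : (U 1).proj - (U 0).proj = realTangent (U 0) := by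
  have hd : ∀ t ∈ Icc (0 : ℝ) 1, HasDerivWithinAt
      (fun τ => (U τ).proj - τ * realTangent (U 0)) ((fun _ => 0) t) (Icc 0 1) t := by
    intro t ht
    have h1 : HasFDerivWithinAt (fun τ => (U τ).proj)
      ((1 : ℝ →L[ℝ] ℝ).smulRight (realTangent (U t))) (Icc 0 1) t := (hU.2 t ht).hasFDerivWithinAt
    have h2 : HasDerivWithinAt (fun τ => (U τ).proj) (realTangent (U 0)) (Icc 0 1) t := by
      refine h1.hasDerivWithinAt.congr_deriv ?_
      exact (one_smul ℝ (realTangent (U t))).trans (hU.1.realTangent_eq ht)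
    have h3 : HasDerivWithinAt (fun τ : ℝ => τ * realTangent (U 0)) (realTangent (U 0))
        (Icc 0 1) t := by
      have := ((hasDerivAt_id t).mul_const (realTangent (U 0))).hasDerivWithinAt (s := Icc 0 1)
      exact this.congr_deriv (one_mul _)
    exact (h2.sub h3).congr_deriv (sub_self _)
  have h := (convex_Icc (0 : ℝ) 1).norm_image_sub_le_of_norm_hasDerivWithin_le (C := 0) hd
    (by simp) (left_mem_Icc.2 zero_le_one) (right_mem_Icc.2 zero_le_one)
  simp only [zero_mul, one_mul, sub_zero] at h
  have := norm_le_zero_iff.1 h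
  linarith

/-- The 1-chain `(t; 1)` on the real line. -/
def unitChain (t : ℝ) : OneChain ℝ ℝ :=
  vectorChain (⟨t, (1 : ℝ)⟩ : TangentBundle 𝓘(ℝ, ℝ) ℝ)

theorem norm_unitChain_sub_le (a b : ℝ) : ‖unitChain b - unitChain a‖ ≤ |b - a| := by
  have hc : ∀ t ∈ Icc (0 : ℝ) 1, HasDerivWithinAt (fun t : ℝ => a + t * (b - a)) (b - a)
      (Icc 0 1) t := fun t _ => by
    simpa using (((hasDerivAt_id t).mul_const (b - a)).const_add a).hasDerivWithinAt
      (s := Icc (0 : ℝ) 1)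
  have hU := (isTransportOperator_zero_real 0).isGeodesicOn (c := fun t => a + t * (b - a))
    (c' := fun _ => b - a) (s := Icc 0 1) (fun t _ => mem_extChartAt_target_real _ _) hc
    (fun t _ => hasDerivWithinAt_const t _ _)
  have hV := (isTransportOperator_zero_real 0).isParallelOn (c := fun t => a + t * (b - a))
    (c' := fun _ => b - a) (V := fun _ => 1) (s := Icc 0 1)
    (fun t _ => mem_extChartAt_target_real _ _) hc (fun t _ => hasDerivWithinAt_const t _ _)
  have h := norm_vectorChain_sub_le hU hV fun _ _ => rfl
  have e1 : ‖(tangentOfCoord (0 : ℝ) (a + 0 * (b - a)) (b - a)).2‖ = |b - a| := by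
    rw [norm_tangent_real, tangentOfCoord_real]
    rfl
  have e2 : ‖(tangentOfCoord (0 : ℝ) (a + 0 * (b - a)) (1 : ℝ)).2‖ = 1 := by
    rw [norm_tangent_real, tangentOfCoord_real]
    exact abs_one
  have h' := h.trans_eq (congrArg₂ (· * ·) e1 e2)
  simpa only [unitChain, tangentOfCoord_real, one_mul, zero_mul, add_zero, add_sub_cancel, mul_one] using h'

end RealLine

/-! ### Midpoint sums and time averages in Banach spaces. -/

section Averages

variable {F : Type*} [NormedAddCommGroup F] [NormedSpace ℝ F] [CompleteSpace F]

theorem norm_integral_sub_midpoint_le {f : ℝ → F} (hf : Continuous f) {L a h : ℝ}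
    (hL : ∀ s t, ‖f s - f t‖ ≤ L * |s - t|) (hL0 : 0 ≤ L) :
    ‖(∫ t in a..a + h, f t) - h • f (a + 1 / 2 * h)‖ ≤ L * |h| * |h| := by
  have h1 : (∫ t in a..a + h, f t) - h • f (a + 1 / 2 * h)
      = ∫ t in a..a + h, (f t - f (a + 1 / 2 * h)) := by
    rw [intervalIntegral.integral_sub (hf.intervalIntegrable _ _) (by simp)]
    simp
  rw [h1]
  have h2 := intervalIntegral.norm_integral_le_of_norm_le_const (a := a) (b := a + h)
    (f := fun t => f t - f (a + 1 / 2 * h)) (C := L * |h|) ?_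
  · simpa using h2
  · intro t ht
    refine (hL _ _).trans (mul_le_mul_of_nonneg_left ?_ hL0)
    have := uIoc_subset_uIcc ht
    rcases le_total 0 h with h0 | h0
    · rw [uIcc_of_le (by linarith)] at this
      rw [abs_of_nonneg h0, abs_le]
      constructor <;> linarith [this.1, this.2]
    · rw [uIcc_of_ge (by linarith)] at this
      rw [abs_of_nonpos h0, abs_le]
      constructor <;> linarith [this.1, this.2]

/-- The midpoint sums of a Lipschitz function over the binary subdivisions of `[0, T]` converge
to its integral. -/
theorem tendsto_midpoint_sum {f : ℝ → F} {L : ℝ} (hL : ∀ s t, ‖f s - f t‖ ≤ L * |s - t|)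
    (hf : Continuous f) (hL0 : 0 ≤ L) (T : ℝ) :
    Tendsto (fun n : ℕ => ∑ i ∈ Finset.range (2 ^ n),
      (T / 2 ^ n) • f (((i : ℝ) + 1 / 2) * (T / 2 ^ n))) atTop (𝓝 (∫ t in (0 : ℝ)..T, f t)) := by
  rw [tendsto_iff_norm_sub_tendsto_zero]
  -- There are `2 ^ n` intervals, each with error at most `L (|T| / 2 ^ n)²`.
  have hlim : Tendsto (fun n : ℕ => L * |T| * |T| * (1 / 2) ^ n) atTop (𝓝 0) := by
    simpa using (tendsto_pow_atTop_nhds_zero_of_lt_one (r := (1 / 2 : ℝ)) (by norm_num)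
      (by norm_num)).const_mul (L * |T| * |T|)
  refine squeeze_zero (fun _ => norm_nonneg _) (fun n => ?_) hlim
  have hn : (2 ^ n : ℝ) ≠ 0 := by positivity
  have h1 : ∫ t in (0 : ℝ)..T, f t = ∑ i ∈ Finset.range (2 ^ n),
      ∫ t in (i : ℝ) * (T / 2 ^ n)..(i : ℝ) * (T / 2 ^ n) + T / 2 ^ n, f t := by
    have := intervalIntegral.sum_integral_adjacent_intervals (μ := MeasureTheory.volume) (f := f)
      (a := fun i : ℕ => (i : ℝ) * (T / 2 ^ n)) (n := 2 ^ n)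
      fun k _ => hf.intervalIntegrable _ _
    simp only [Nat.cast_add, Nat.cast_one, add_mul, one_mul, Nat.cast_zero, zero_mul,
      Nat.cast_pow, Nat.cast_ofNat, mul_div_cancel₀ _ hn] at this
    exact this.symm
  rw [h1, norm_sub_rev, ← Finset.sum_sub_distrib]
  refine (norm_sum_le _ _).trans ((Finset.sum_le_card_nsmul _ _ (L * |T / 2 ^ n| * |T / 2 ^ n|)
    fun i _ => ?_).trans_eq ?_)
  · rw [add_mul]
    exact norm_integral_sub_midpoint_le hf hL hL0
  · rw [Finset.card_range, nsmul_eq_mul, abs_div, abs_of_pos (by positivity : (0 : ℝ) < 2 ^ n),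
      div_pow, one_pow]
    push_cast
    field_simp

theorem norm_average_le {f : ℝ → F} {C T : ℝ} (hT : 0 < T) (hf : ∀ t, ‖f t‖ ≤ C) :
    ‖T⁻¹ • ∫ t in (0 : ℝ)..T, f t‖ ≤ C := by
  have h := intervalIntegral.norm_integral_le_of_norm_le_const (a := 0) (b := T) (f := f) (C := C)
    fun t _ => hf t
  rw [sub_zero, abs_of_pos hT] at h
  rw [norm_smul, Real.norm_eq_abs, abs_of_pos (inv_pos.2 hT), inv_mul_le_iff₀ hT]
  linarith

variable {M : Type*} [TopologicalSpace M] [CompactSpace M] [T2Space M]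

/-- Take a partition of unity subordinate to a finite cover by sets on which `g` stays within `ε` of
`g i`. The approximation has scalar coefficients, to which quasi-regularity applies. -/
theorem exists_norm_sub_sum_smul_le {g : M → F} (hg : Continuous g) {ε : ℝ} (hε : 0 < ε) :
    ∃ (s : Finset M) (ρ : M → C(M, ℝ)), ∀ q, ‖g q - ∑ i ∈ s, ρ i q • g i‖ ≤ ε := by
  have hopen (i : M) : IsOpen {q | ‖g q - g i‖ < ε} :=
    isOpen_lt (by fun_prop) continuous_const
  obtain ⟨s, hs⟩ := isCompact_univ.elim_finite_subcover (fun i : M => {q | ‖g q - g i‖ < ε}) hopen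
    fun q _ => mem_iUnion.2 ⟨q, by simpa using hε⟩
  obtain ⟨ρ, hρ⟩ := PartitionOfUnity.exists_isSubordinate_of_locallyFinite (s := univ)
    isClosed_univ (fun i : s => {q | ‖g q - g i‖ < ε}) (fun i => hopen i)
    (locallyFinite_of_finite _) (by simpa [iUnion_subtype] using hs)
  classical
  refine ⟨s, fun i => if h : i ∈ s then ρ ⟨i, h⟩ else 0, fun q => ?_⟩
  have hsum : ∑ i : s, ρ i q = 1 := by
    rw [← finsum_eq_sum_of_fintype]
    exact ρ.sum_eq_one (mem_univ q)
  have h1 : ∑ i ∈ s, (if h : i ∈ s then ρ ⟨i, h⟩ else 0 : C(M, ℝ)) q • g i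
      = ∑ i : s, ρ i q • g i := by
    rw [← Finset.sum_coe_sort s]
    exact Finset.sum_congr rfl fun i _ => by rw [dif_pos i.2]
  have h2 : g q = ∑ i : s, ρ i q • g q := by rw [← Finset.sum_smul, hsum, one_smul]
  rw [h1]
  nth_rewrite 1 [h2]
  rw [← Finset.sum_sub_distrib]
  calc ‖∑ i : s, (ρ i q • g q - ρ i q • g i)‖ ≤ ∑ i : s, ρ i q * ε := by
        refine norm_sum_le_of_le _ fun i _ => ?_
        rw [← smul_sub, norm_smul, Real.norm_eq_abs, abs_of_nonneg (ρ.nonneg i q)]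
        by_cases h0 : ρ i q = 0
        · simp [h0]
        · have : q ∈ {q | ‖g q - g i‖ < ε} := hρ i (subset_closure h0)
          exact mul_le_mul_of_nonneg_left (le_of_lt this) (ρ.nonneg i q)
    _ = ε := by rw [← Finset.sum_mul, hsum, one_mul]

/-- Along the orbit of a quasi-regular point, continuous functions with values in a Banach space
have time averages. -/
theorem IsQuasiRegular.exists_tendsto_average {φ : ℝ → M} (hp : IsQuasiRegular φ)
    (hφ : Continuous φ) {g : M → F} (hg : Continuous g) :
    ∃ J : F, Tendsto (fun T : ℝ => T⁻¹ • ∫ t in (0 : ℝ)..T, g (φ t)) atTop (𝓝 J) := by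
  refine CompleteSpace.complete (Metric.cauchy_iff.2 ⟨inferInstance, fun ε hε => ?_⟩)
  obtain ⟨s, ρ, hρ⟩ := exists_norm_sub_sum_smul_le hg (show 0 < ε / 8 by positivity)
  choose L hL using fun i => hp (ρ i)
  have hint (i : M) (T : ℝ) :
      IntervalIntegrable (fun t => ρ i (φ t) • g i) MeasureTheory.volume 0 T := by
    apply Continuous.intervalIntegrable
    fun_prop
  have hlim : Tendsto (fun T : ℝ => T⁻¹ • ∫ t in (0 : ℝ)..T, ∑ i ∈ s, ρ i (φ t) • g i) atTop
      (𝓝 (∑ i ∈ s, L i • g i)) := by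
    have := tendsto_finsetSum s fun i _ => (hL i).smul_const (g i)
    refine this.congr fun T => ?_
    rw [intervalIntegral.integral_finsetSum fun i _ => hint i T, Finset.smul_sum]
    exact Finset.sum_congr rfl fun i _ => by rw [intervalIntegral.integral_smul_const, smul_smul]
  obtain ⟨T₀, hT₀⟩ := eventually_atTop.1 (Metric.tendsto_nhds.1 hlim (ε / 8) (by positivity))
  -- Half of `ε / 4` is the approximation error, which averaging does not increase, and half the
  -- distance of the approximate average from its limit. The bound `1` ensures `T > 0`.
  have key : ∀ T ≥ max T₀ 1, dist (T⁻¹ • ∫ t in (0 : ℝ)..T, g (φ t)) (∑ i ∈ s, L i • g i)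
      ≤ ε / 4 := fun T hT => by
    have h1 := (hT₀ T ((le_max_left _ _).trans hT)).le
    have h2 := norm_average_le (f := fun t => g (φ t) - ∑ i ∈ s, ρ i (φ t) • g i)
      (zero_lt_one.trans_le ((le_max_right _ _).trans hT)) fun t => hρ (φ t)
    rw [intervalIntegral.integral_sub (Continuous.intervalIntegrable (by fun_prop) _ _)
      (Continuous.intervalIntegrable (by fun_prop) _ _), smul_sub, ← dist_eq_norm] at h2
    linarith [dist_triangle (T⁻¹ • ∫ t in (0 : ℝ)..T, g (φ t))
      (T⁻¹ • ∫ t in (0 : ℝ)..T, ∑ i ∈ s, ρ i (φ t) • g i) (∑ i ∈ s, L i • g i)]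
  refine ⟨_, image_mem_map (Ici_mem_atTop (max T₀ 1)), ?_⟩
  rintro _ ⟨T, hT, rfl⟩ _ ⟨T', hT', rfl⟩
  have h := dist_triangle_right (T⁻¹ • ∫ t in (0 : ℝ)..T, g (φ t))
    (T'⁻¹ • ∫ t in (0 : ℝ)..T', g (φ t)) (∑ i ∈ s, L i • g i)
  linarith [key T hT, key T' hT']

end Averages

theorem coe_intervalApprox (T : ℝ) (n : ℕ) :
    (intervalApprox T n : OneChain ℝ ℝ) = ∑ i ∈ Finset.range (2 ^ n),
      (T / 2 ^ n) • unitChain (((i : ℝ) + 1 / 2) * (T / 2 ^ n)) := by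
  have h (A : PointedOneChain ℝ ℝ) :
      (A : OneChain ℝ ℝ) = UniformSpace.Completion.toComplL (𝕜 := ℝ) A := rfl
  rw [h, intervalApprox, map_sum]
  refine Finset.sum_congr rfl fun i _ => ?_
  rw [unitChain, vectorChain, h, ← map_smul, smul_oneElement]
  congr 1
  exact congrArg (oneElementLinear ℝ _) (mul_one (T / 2 ^ n : ℝ)).symm

theorem continuous_unitChain : Continuous unitChain := by
  refine (LipschitzWith.of_dist_le_mul (K := 1) fun a b => ?_).continuous
  rw [dist_eq_norm, NNReal.coe_one, one_mul, Real.dist_eq]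
  exact norm_unitChain_sub_le b a

theorem intervalChain_eq (T : ℝ) : intervalChain T = ∫ t in (0 : ℝ)..T, unitChain t := by
  refine Tendsto.limUnder_eq ?_
  simp only [coe_intervalApprox]
  exact tendsto_midpoint_sum (L := 1)
    (fun s t => by rw [one_mul]; exact norm_unitChain_sub_le t s) continuous_unitChain zero_le_one T

/-! ### The orbit chain as an integral, and its boundary. -/

section OrbitChain

variable {E : Type*} [NormedAddCommGroup E] [NormedSpace ℝ E]
  {M : Type*} [TopologicalSpace M] [ChartedSpace E M] [IsManifold 𝓘(ℝ, E) ∞ M]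
  [RiemannianBundle (fun x : M => TangentSpace 𝓘(ℝ, E) x)]

theorem pointedPushforward_oneElement {X : ∀ x : M, TangentSpace 𝓘(ℝ, E) x} {φ : ℝ → M}
    (hφ : IsMIntegralCurve φ X) (z : TangentBundle 𝓘(ℝ, ℝ) ℝ) :
    (pointedPushforward φ (oneElement z) : PointedOneChain E M)
      = realTangent z • oneElement ⟨φ z.proj, X (φ z.proj)⟩ := by
  classical
  have h : (pointedPushforward φ (oneElement z) : PointedOneChain E M)
      = oneElementLinear E (φ z.proj) (mfderiv 𝓘(ℝ, ℝ) 𝓘(ℝ, E) φ z.proj z.2) :=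
    DFinsupp.lsum_single (M := fun x : ℝ => TangentSpace 𝓘(ℝ, ℝ) x) ℝ _ _ _
  rw [h, (hφ z.proj).mfderiv]
  exact (oneElementLinear E (φ z.proj)).map_smul (realTangent z) (X (φ z.proj))

/-- A difference on the line carries the same number `v` from `a` to `b` with displacement `b - a`,
so its image is `v` times a difference of `(φ t; X (φ t))`. The Lipschitz bound along the orbit
controls it by `Λ` times the weight. -/
theorem exists_pushforward_extension {X : ∀ x : M, TangentSpace 𝓘(ℝ, E) x} {φ : ℝ → M}
    (hφ : IsMIntegralCurve φ X) {Λ : ℝ} (hΛ : 0 ≤ Λ) (hb : ∀ t, ‖X (φ t)‖ ≤ Λ)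
    (hl : ∀ s t, ‖vectorChain ⟨φ s, X (φ s)⟩ - vectorChain ⟨φ t, X (φ t)⟩‖ ≤ Λ * |s - t|) :
    ∃ T : OneChain ℝ ℝ →L[ℝ] OneChain E M, pushforward φ = T ∧
      ∀ t, T (unitChain t) = vectorChain ⟨φ t, X (φ t)⟩ := by
  let f : PointedOneChain ℝ ℝ →ₗ[ℝ] OneChain E M :=
    (UniformSpace.Completion.toComplL (𝕜 := ℝ) (E := PointedOneChain E M)).toLinearMap.comp
      (pointedPushforward φ)
  have hf (z : TangentBundle 𝓘(ℝ, ℝ) ℝ) :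
      f (oneElement z) = realTangent z • vectorChain ⟨φ z.proj, X (φ z.proj)⟩ := by
    have h : f (oneElement z) = (UniformSpace.Completion.toComplL (𝕜 := ℝ)
      (E := PointedOneChain E M)) (pointedPushforward φ (oneElement z)) := rfl
    rw [h, pointedPushforward_oneElement hφ, map_smul]
    rfl
  obtain ⟨T, hT, he⟩ := exists_extension f (C := Λ) <| norm_map_le_of_isOneDifference f hΛ
    fun A w h => by
      cases h with
      | order_zero z =>
        rw [hf, norm_smul, norm_tangent_real, Real.norm_eq_abs, mul_comm]
        gcongr
        exact (norm_vectorChain_le _).trans (hb _)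
      | order_one U V hU hV hUV =>
        rw [map_sub, hf, hf, hV.realTangent_eq (right_mem_Icc.2 zero_le_one), ← smul_sub,
          norm_smul, norm_tangent_real, norm_tangent_real, Real.norm_eq_abs,
          hUV 1 (right_mem_Icc.2 zero_le_one), hUV 0 (left_mem_Icc.2 zero_le_one),
          ← hU.proj_sub_eq_real, mul_comm, ← mul_assoc]
        gcongr
        exact hl _ _
  refine ⟨T, he, fun t => ?_⟩
  rw [unitChain, vectorChain, hT, hf]
  exact one_smul ℝ _

variable [FiniteDimensional ℝ E]
  [IsContMDiffRiemannianBundle 𝓘(ℝ, E) ∞ E (fun x : M => TangentSpace 𝓘(ℝ, E) x)]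
  [CompactSpace M]

theorem orbitChain_eq {X : ∀ x : M, TangentSpace 𝓘(ℝ, E) x} (hX : IsLipschitzVectorField X)
    {φ : ℝ → M} (hφ : IsMIntegralCurve φ X) (T : ℝ) :
    (orbitChain φ T : OneChain E M) =
      T⁻¹ • ∫ t in (0 : ℝ)..T, vectorChain ⟨φ t, X (φ t)⟩ := by
  obtain ⟨Λ, hΛ, hb, hl⟩ := hX.exists_orbit_bound hφ
  obtain ⟨P, hP, hu⟩ := exists_pushforward_extension hφ hΛ hb hl
  rw [orbitChain, hP, intervalChain_eq, ← ContinuousLinearMap.intervalIntegral_comp_comm _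
    (continuous_unitChain.intervalIntegrable _ _)]
  simp only [hu]

/-- Apply the bounded operator `∂` under the integral; `∂(φ t; X (φ t))` is the derivative of `t ↦
(φ t; 1)`, and the fundamental theorem of calculus applies. -/
theorem boundary_orbitChain {X : ∀ x : M, TangentSpace 𝓘(ℝ, E) x} (hX : IsLipschitzVectorField X)
    {φ : ℝ → M} (hφ : IsMIntegralCurve φ X) (T : ℝ) :
    boundary (orbitChain φ T : OneChain E M)
      = T⁻¹ • (pointChain E (φ T) - pointChain E (φ 0)) := by
  obtain ⟨B, hB, hv⟩ := exists_boundary_extension (E := E) (M := M)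
  have hc : Continuous fun t => vectorChain (⟨φ t, X (φ t)⟩ : TangentBundle 𝓘(ℝ, E) M) :=
    hX.continuous_vectorChain.comp hφ.continuous
  have hBc : Continuous fun t => B (vectorChain ⟨φ t, X (φ t)⟩) := B.continuous.comp hc
  rw [orbitChain_eq hX hφ, hB, map_smul,
    ← ContinuousLinearMap.intervalIntegral_comp_comm _ (hc.intervalIntegrable _ _),
    intervalIntegral.integral_eq_sub_of_hasDerivAt (f := fun t => pointChain E (φ t))
      (fun t _ => ?_) (hBc.intervalIntegrable _ _)]
  rw [hv]
  exact hasDerivAt_pointChain (hφ t)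

end OrbitChain

end DifferentialChain

end

theorem mainTheorem9
    {E : Type*} [NormedAddCommGroup E] [NormedSpace ℝ E] [FiniteDimensional ℝ E]
    {M : Type*} [TopologicalSpace M] [T2Space M] [CompactSpace M]
    [ChartedSpace E M] [IsManifold 𝓘(ℝ, E) ∞ M]
    [RiemannianBundle (fun x : M => TangentSpace 𝓘(ℝ, E) x)]
    [IsContMDiffRiemannianBundle 𝓘(ℝ, E) ∞ E (fun x : M => TangentSpace 𝓘(ℝ, E) x)]
    (X : ∀ x : M, TangentSpace 𝓘(ℝ, E) x) (hX : DifferentialChain.IsLipschitzVectorField X)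
    (p : M) (φ : ℝ → M) (hφ : IsMIntegralCurve φ X) (hφp : φ 0 = p)
    (hp : DifferentialChain.IsQuasiRegular φ) :
    ∃ J : DifferentialChain.OneChain E M,
      Tendsto (fun T : ℝ => (DifferentialChain.orbitChain φ T : DifferentialChain.OneChain E M))
        atTop (𝓝 J) ∧
      DifferentialChain.boundary J = 0 := by
  open DifferentialChain in
  obtain ⟨J, hJ⟩ := hp.exists_tendsto_average hφ.continuous hX.continuous_vectorChain
  simp only [← orbitChain_eq hX hφ] at hJ
  obtain ⟨B, hB, -⟩ := exists_boundary_extension (E := E) (M := M)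
  have hcont : Continuous (boundary : OneChain E M → ZeroChain E M) := hB ▸ B.continuous
  refine ⟨J, hJ, tendsto_nhds_unique ((hcont.tendsto J).comp hJ) ?_⟩
  -- Each point chain has norm at most `1`, so the endpoint formula bounds `∂J_T` by `2 |T⁻¹|`.
  have hlim : Tendsto (fun T : ℝ => |T⁻¹| * 2) atTop (𝓝 0) := by
    simpa using (tendsto_inv_atTop_zero (𝕜 := ℝ)).abs.mul_const 2
  refine squeeze_zero_norm (fun T => ?_) hlim
  rw [Function.comp_apply, boundary_orbitChain hX hφ, norm_smul, Real.norm_eq_abs]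
  gcongr
  linarith [norm_sub_le (pointChain E (φ T)) (pointChain E (φ 0)),
    norm_pointChain_le (E := E) (φ T), norm_pointChain_le (E := E) (φ 0)]
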